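/- **Theorem.** Work in $\mathsf{ZFC}$. If $\mathcal{USR}(\mathrm{PwSt})$ is defined, then for every natural number $n>0$ there exists an $n$-extendible cardinal. The notions are as follows. Vocabularies are sets and may be many-sorted, domains of structures are nonempty sets, and $|\mathcal A|$ is the total number of elements of the domains of $\mathcal A$. Vocabularies and structures are themselves regarded as sets. * $\mathrm{PwSt}(x,y)$ is the predicate "$y=\wp(x)$". * A non-decreasing function $F:\mathrm{Card}\to\mathrm{Card}$ is *definably bounding* if there are a many-sorted vocabulary $\tau'$ with two distinct distinguished sorts $s_0,s_1$ and a first-order $\tau'$-sentence $\phi$ such that (i) for all nonempty sets $A,B$: $|B|\le F(|A|)$ if and only if some model of $\phi$ has, up to bijections, $A$ and $B$ as its domains of sorts $s_0$ and $s_1$; and (ii) for all nonempty sets $A,B$ there is a cardinal $\lambda$ such that every model of $\phi$ whose domains of sorts $s_0,s_1$ are, up to bijections, $A$ and $B$ has cardinality at most $\lambda$. * $\rho_{\mathbf H}(x)=\max(\aleph_0,|\mathrm{trcl}(x)|)$, where $\mathrm{trcl}$ is the transitive closure. * A class $C$ of sets is *$\Sigma_1^F(R)$-definable* if there is a $\Delta_0$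 formula $\psi(x,y)$ in the language $\{\in,R\}$, without parameters, such that $x\in C\leftrightarrow\exists y\,\psi(x,y)$ for all $x$, and for every $x\in C$ there is $y$ with $\psi(x,y)$ and $\rho_{\mathbf H}(y)\le F(\rho_{\mathbf H}(x))$. * $\mathcal{USR}(R)$ is the least cardinal $\kappa$ such that for every definably bounding $F$, every vocabulary $\tau$ for which $\{\tau\}$ is $\Sigma_1^F(R)$-definable, and every $\Sigma_1^F(R)$-definable class $\mathcal K$ of $\tau$-structures closed under isomorphisms: for every $\mathcal A\in\mathcal K$ with $|\mathcal A|\ge\kappa$ and every cardinal $\kappa'>\kappa$ there is $\mathcal B\in\mathcal K$ with $|\mathcal B|\ge\kappa'$ and a first-order elementary embedding $e:\mathcal A\to\mathcal B$. If there is no such $\kappa$, then $\mathcal{USR}(R)$ is undefined. * For an ordinal $\eta$, a cardinal $\kappa$ is *$\eta$-extendible* if for some ordinal $\zeta$ there is an elementary embedding $j:(V_{\kappa+\eta},\in)\to(V_\zeta,\in)$ with critical point $\kappa$ and $\eta<j(\kappa)$. -/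

import Mathlib

/-! ### Many-sorted first-order logic -/

/-- A many-sorted vocabulary: sorts, relation symbols and function symbols, where every symbol comes
with the sorts of its arguments (and of its value). Constants are function symbols without
arguments. -/
structure MSLang.{v} where
  S : Type v
  R : Type v
  F : Type v
  relArgs : R → List S
  funArgs : F → List S
  funOut : F → S

/-- Assignments of elements to a list of sorts, where `D s` is the domain of sort `s`. -/
abbrev SortedTuple.{v, w} {S : Type v} (D : S → Type w) (l : List S) : Type w :=
  (i : Fin l.length) → D (l.get i)

/-- A structure for a many-sorted vocabulary; as usual every domain is nonempty. -/
structure MSStr.{v, w} (L : MSLang.{v}) where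
  Dom : L.S → Type w
  nonempty : ∀ s, Nonempty (Dom s)
  rel : (r : L.R) → SortedTuple Dom (L.relArgs r) → Prop
  func : (f : L.F) → SortedTuple Dom (L.funArgs f) → Dom (L.funOut f)

/-- Terms of the indicated sort, with one variable for each position of the list `Γ` of sorts. -/
inductive MSTerm.{v} (L : MSLang.{v}) (Γ : List L.S) : L.S → Type v
  | var (i : Fin Γ.length) : MSTerm L Γ (Γ.get i)
  | app (f : L.F) (ts : (i : Fin (L.funArgs f).length) → MSTerm L Γ ((L.funArgs f).get i)) :
      MSTerm L Γ (L.funOut f)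

/-- First-order formulas whose free variables are the positions of the list `Γ` of sorts; in
`all s φ` the quantified variable is position `0` of `s :: Γ`. -/
inductive MSFormula.{v} (L : MSLang.{v}) : List L.S → Type v
  | eq {Γ : List L.S} (s : L.S) (t₁ t₂ : MSTerm L Γ s) : MSFormula L Γ
  | rel {Γ : List L.S} (r : L.R)
      (ts : (i : Fin (L.relArgs r).length) → MSTerm L Γ ((L.relArgs r).get i)) : MSFormula L Γ
  | neg {Γ : List L.S} (φ : MSFormula L Γ) : MSFormula L Γ
  | and {Γ : List L.S} (φ ψ : MSFormula L Γ) : MSFormula L Γ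
  | all {Γ : List L.S} (s : L.S) (φ : MSFormula L (s :: Γ)) : MSFormula L Γ

/-- Extend an assignment by a value for a new variable at position `0`. -/
def SortedTuple.cons.{v, w} {S : Type v} {D : S → Type w} {l : List S} {s : S} (a : D s)
    (x : SortedTuple D l) : SortedTuple D (s :: l)
  | ⟨0, _⟩ => a
  | ⟨i + 1, h⟩ => x ⟨i, Nat.lt_of_succ_lt_succ h⟩

/-- The value of a term in a structure under an assignment. -/
def MSTerm.eval.{v, w} {L : MSLang.{v}} (M : MSStr.{v, w} L) {Γ : List L.S}
    (x : SortedTuple M.Dom Γ) : {s : L.S} → MSTerm L Γ s → M.Dom s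
  | _, .var i => x i
  | _, .app f ts => M.func f fun i => (ts i).eval M x

/-- Tarskian satisfaction of a formula in a structure under an assignment. -/
def MSFormula.Sat.{v, w} {L : MSLang.{v}} (M : MSStr.{v, w} L) :
    {Γ : List L.S} → MSFormula L Γ → SortedTuple M.Dom Γ → Prop
  | _, .eq _ t₁ t₂, x => t₁.eval M x = t₂.eval M x
  | _, .rel r ts, x => M.rel r fun i => (ts i).eval M x
  | _, .neg φ, x => ¬ φ.Sat M x
  | _, .and φ ψ, x => φ.Sat M x ∧ ψ.Sat M x
  | _, .all s φ, x => ∀ a : M.Dom s, φ.Sat M (SortedTuple.cons a x)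

/-- Truth of a sentence in a structure. -/
def MSStr.Models.{v, w} {L : MSLang.{v}} (M : MSStr.{v, w} L) (φ : MSFormula L []) : Prop :=
  φ.Sat M fun i => i.elim0

/-- The cardinality of a many-sorted structure: the total number of elements of its domains. -/
def MSStr.card.{u} {L : MSLang.{u}} (M : MSStr.{u, u} L) : Cardinal.{u} :=
  Cardinal.mk ((s : L.S) × M.Dom s)

/-- A sort-preserving family of maps is an (`L_ωω`-)elementary embedding. -/
def MSStr.IsElementary.{v, w} {L : MSLang.{v}} (M N : MSStr.{v, w} L)
    (e : (s : L.S) → M.Dom s → N.Dom s) : Prop :=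
  ∀ (Γ : List L.S) (φ : MSFormula L Γ) (x : SortedTuple M.Dom Γ),
    φ.Sat M x ↔ φ.Sat N fun i => e _ (x i)

/-- Two structures are isomorphic. -/
def MSStr.Isomorphic.{v, w} {L : MSLang.{v}} (M N : MSStr.{v, w} L) : Prop :=
  ∃ e : (s : L.S) → M.Dom s ≃ N.Dom s,
    (∀ r x, M.rel r x ↔ N.rel r fun i => e _ (x i)) ∧
    ∀ f x, e _ (M.func f x) = N.func f fun i => e _ (x i)

/-! ### Definably bounding functions -/

/-- `F` is definably bounding: it is non-decreasing and the class of all two-sorted structures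
`(A, B)` without symbols such that `|B| ≤ F(|A|)` is a bounded projection of the class of models of
a first-order sentence `φ`. Here `L` is a vocabulary extending the two sorts `a`, `b`, the reduct of
`M` to `{a, b}` is `(M.Dom a, M.Dom b)`, and the last clause bounds the size of all models of `φ`
with a given reduct. -/
def IsDefinablyBounding.{u} (F : Cardinal.{u} → Cardinal.{u}) : Prop :=
  Monotone F ∧
  ∃ (L : MSLang.{u}) (a b : L.S) (φ : MSFormula L []), a ≠ b ∧
    (∀ A B : Type u, Nonempty A → Nonempty B →
      (Cardinal.mk B ≤ F (Cardinal.mk A) ↔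
        ∃ M : MSStr.{u, u} L,
          M.Models φ ∧ Nonempty (M.Dom a ≃ A) ∧ Nonempty (M.Dom b ≃ B))) ∧
    ∀ A B : Type u, Nonempty A → Nonempty B →
      ∃ bound : Cardinal.{u}, ∀ M : MSStr.{u, u} L,
        M.Models φ → Nonempty (M.Dom a ≃ A) → Nonempty (M.Dom b ≃ B) → M.card ≤ bound

/-! ### The complexity classes `Σ₁^F(R)` -/

/-- The transitive closure of a set (the least transitive set including it); it is cut out of
`V_ (rank x)`, a transitive set that includes `x`. -/
noncomputable def ZFSet.trcl.{u} (x : ZFSet.{u}) : ZFSet.{u} :=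
  ZFSet.sep (fun z => ∀ t : ZFSet.{u}, t.IsTransitive → x ⊆ t → z ∈ t)
    (ZFSet.vonNeumann x.rank)

theorem ZFSet.mem_trcl.{u} {x z : ZFSet.{u}} :
    z ∈ x.trcl ↔ ∀ t : ZFSet.{u}, t.IsTransitive → x ⊆ t → z ∈ t := by
  unfold ZFSet.trcl
  rw [ZFSet.mem_sep]
  exact ⟨fun h => h.2, fun h =>
    ⟨h _ (ZFSet.isTransitive_vonNeumann _) (ZFSet.subset_vonNeumann_self x), h⟩⟩

theorem ZFSet.subset_trcl.{u} (x : ZFSet.{u}) : x ⊆ x.trcl :=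
  fun _ hz => ZFSet.mem_trcl.2 fun _ _ h => h hz

theorem ZFSet.isTransitive_trcl.{u} (x : ZFSet.{u}) : x.trcl.IsTransitive :=
  fun _ hy _ hz => ZFSet.mem_trcl.2 fun t ht h => ht _ (ZFSet.mem_trcl.1 hy t ht h) hz

/-- The `H`-rank of `x`: the least infinite cardinal `κ` with `x ∈ H_{κ⁺}`, that is, with
`|trcl x| < κ⁺`. -/
noncomputable def ZFSet.hRank.{u} (x : ZFSet.{u}) : Cardinal.{u} :=
  max Cardinal.aleph0 x.trcl.card

theorem ZFSet.isLeast_hRank.{u} (x : ZFSet.{u}) :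
    IsLeast {κ : Cardinal.{u} | Cardinal.aleph0 ≤ κ ∧ x.trcl.card < Order.succ κ} x.hRank := by
  refine ⟨⟨le_max_left _ _, Order.lt_succ_of_le (le_max_right _ _)⟩, ?_⟩
  rintro κ ⟨h₁, h₂⟩
  exact max_le h₁ (Order.lt_succ_iff.1 h₂)

/-- `Δ₀(R)`-formulas, for a `k`-ary predicate symbol `R`, in the variables `0, …, n - 1`. The
only quantifier is the bounded one: `ball i φ` is `∀ z ∈ xᵢ, φ`, where `z` becomes variable `0`
of `φ` and the old variables are shifted by one. -/
inductive Delta0 (k : ℕ) : ℕ → Type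
  | eq {n : ℕ} (i j : Fin n) : Delta0 k n
  | mem {n : ℕ} (i j : Fin n) : Delta0 k n
  | pred {n : ℕ} (i : Fin k → Fin n) : Delta0 k n
  | neg {n : ℕ} (φ : Delta0 k n) : Delta0 k n
  | and {n : ℕ} (φ ψ : Delta0 k n) : Delta0 k n
  | ball {n : ℕ} (i : Fin n) (φ : Delta0 k (n + 1)) : Delta0 k n

/-- Truth of a `Δ₀(R)`-formula in the universe of sets. -/
def Delta0.Holds.{u} {k : ℕ} (R : (Fin k → ZFSet.{u}) → Prop) :
    {n : ℕ} → Delta0 k n → (Fin n → ZFSet.{u}) → Prop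
  | _, .eq i j, x => x i = x j
  | _, .mem i j, x => x i ∈ x j
  | _, .pred i, x => R fun l => x (i l)
  | _, .neg φ, x => ¬ φ.Holds R x
  | _, .and φ ψ, x => φ.Holds R x ∧ ψ.Holds R x
  | _, .ball i φ, x => ∀ z ∈ x i, φ.Holds R (Fin.cons z x)

/-- The class `C` of sets is definable, without parameters, by a `Σ₁^F(R)`-formula `∃ y, ψ(x, y)`:
whenever there is a witness `y`, there is one of `H`-rank at most `F` of the `H`-rank of `x`. -/
def IsSigma1Definable.{u} {k : ℕ} (R : (Fin k → ZFSet.{u}) → Prop)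
    (F : Cardinal.{u} → Cardinal.{u}) (C : Set ZFSet.{u}) : Prop :=
  ∃ ψ : Delta0 k 2,
    (∀ x, x ∈ C ↔ ∃ y, ψ.Holds R ![x, y]) ∧
    ∀ x ∈ C, ∃ y : ZFSet.{u}, y.hRank ≤ F x.hRank ∧ ψ.Holds R ![x, y]

/-- The binary predicate `PwSt(x, y)`, saying that `y` is the power set of `x`. -/
def PwSt.{u} (x : Fin 2 → ZFSet.{u}) : Prop :=
  x 1 = ZFSet.powerset (x 0)

/-! ### Vocabularies and structures as sets -/

/-- Finite sequences as sets. -/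
def ZFSet.tuple.{u} : List ZFSet.{u} → ZFSet.{u}
  | [] => ∅
  | a :: l => ZFSet.pair a (ZFSet.tuple l)

/-- A many-sorted vocabulary whose sorts and symbols form sets. -/
structure SetVocab.{u} where
  sorts : ZFSet.{u}
  rels : ZFSet.{u}
  funs : ZFSet.{u}
  relArgs : rels → List sorts
  funArgs : funs → List sorts
  funOut : funs → sorts

/-- The vocabulary underlying a set-sized vocabulary. -/
def SetVocab.lang.{u} (τ : SetVocab.{u}) : MSLang.{u + 1} where
  S := τ.sorts
  R := τ.rels
  F := τ.funs
  relArgs := τ.relArgs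
  funArgs := τ.funArgs
  funOut := τ.funOut

/-- The vocabulary as a set: the triple consisting of the set of sorts, the function that maps every
relation symbol to the sequence of the sorts of its arguments, and the function that maps every
function symbol to the sequence of the sort of its value and the sorts of its arguments. -/
noncomputable def SetVocab.code.{u} (τ : SetVocab.{u}) : ZFSet.{u} :=
  ZFSet.tuple [τ.sorts,
    ZFSet.range fun r : τ.rels =>
      ZFSet.pair r (ZFSet.tuple ((τ.relArgs r).map fun s => (s : ZFSet.{u}))),
    ZFSet.range fun f : τ.funs =>
      ZFSet.pair f (ZFSet.tuple ((τ.funOut f :: τ.funArgs f).map fun s => (s : ZFSet.{u})))]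

/-- A structure in the vocabulary `τ` whose domains are sets. -/
structure SetStr.{u} (τ : SetVocab.{u}) where
  dom : τ.sorts → ZFSet.{u}
  nonempty : ∀ s, (dom s).Nonempty
  rel : (r : τ.rels) → SortedTuple (fun s => dom s) (τ.relArgs r) → Prop
  func : (f : τ.funs) → SortedTuple (fun s => dom s) (τ.funArgs f) → dom (τ.funOut f)

/-- The many-sorted structure underlying a structure whose domains are sets. -/
def SetStr.toMSStr.{u} {τ : SetVocab.{u}} (A : SetStr.{u} τ) : MSStr.{u + 1, u + 1} τ.lang where
  Dom := fun s => A.dom s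
  nonempty := fun s => let ⟨x, hx⟩ := A.nonempty s; ⟨⟨x, hx⟩⟩
  rel := A.rel
  func := A.func

/-- The set coding an assignment of elements of a structure to a list of sorts. -/
def SetStr.tupleCode.{u} {τ : SetVocab.{u}} (A : SetStr.{u} τ) {l : List τ.sorts}
    (x : SortedTuple (fun s => A.dom s) l) : ZFSet.{u} :=
  ZFSet.tuple (List.ofFn fun i => (x i : ZFSet.{u}))

/-- The structure as a set: the triple consisting of the function that maps every sort to its
domain, the function that maps every relation symbol to the set of tuples in its interpretation, and
the function that maps every function symbol to the graph of its interpretation (the set of all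
sequences consisting of a value followed by its arguments). -/
noncomputable def SetStr.code.{u} {τ : SetVocab.{u}} (A : SetStr.{u} τ) : ZFSet.{u} :=
  ZFSet.tuple [
    ZFSet.range fun s : τ.sorts => ZFSet.pair s (A.dom s),
    ZFSet.range fun r : τ.rels => ZFSet.pair r
      (ZFSet.range fun x : {x : SortedTuple (fun s => A.dom s) (τ.relArgs r) // A.rel r x} =>
        A.tupleCode x.1),
    ZFSet.range fun f : τ.funs => ZFSet.pair f
      (ZFSet.range fun x : SortedTuple (fun s => A.dom s) (τ.funArgs f) =>
        ZFSet.pair (A.func f x) (A.tupleCode x))]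

/-- The cardinality of a structure: the total number of elements of its domains. -/
noncomputable def SetStr.card.{u} {τ : SetVocab.{u}} (A : SetStr.{u} τ) : Cardinal.{u} :=
  Cardinal.mk (Shrink.{u} ((s : τ.sorts) × A.dom s))

/-! ### Upwards structural reflection -/

/-- Upwards structural reflection for `R` holds at `κ`: for every definably bounding `F`, every
`Σ₁^F(R)`-definable vocabulary `τ` and every `Σ₁^F(R)`-definable class `K` of `τ`-structures closed
under isomorphisms, every `A ∈ K` of size at least `κ` embeds elementarily into elements of `K` of
arbitrarily large size. -/
def ReflectsUpwards.{u} {k : ℕ} (R : (Fin k → ZFSet.{u}) → Prop) (κ : Cardinal.{u}) : Prop :=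
  ∀ F : Cardinal.{u} → Cardinal.{u}, IsDefinablyBounding F →
  ∀ τ : SetVocab.{u}, IsSigma1Definable R F {τ.code} →
  ∀ K : Set (SetStr.{u} τ),
    (∀ A ∈ K, ∀ B : SetStr.{u} τ, A.toMSStr.Isomorphic B.toMSStr → B ∈ K) →
    IsSigma1Definable R F (SetStr.code '' K) →
  ∀ A ∈ K, κ ≤ A.card → ∀ κ' : Cardinal.{u}, κ < κ' →
    ∃ B ∈ K, κ' ≤ B.card ∧
      ∃ e : (s : τ.sorts) → A.dom s → B.dom s, A.toMSStr.IsElementary B.toMSStr e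

/-- The bounded upwards structural reflection number of `R` is defined and equal to `κ`. -/
def IsUSR.{u} {k : ℕ} (R : (Fin k → ZFSet.{u}) → Prop) (κ : Cardinal.{u}) : Prop :=
  IsLeast {μ : Cardinal.{u} | ReflectsUpwards R μ} κ

/-! ### Extendible cardinals -/

/-- The only symbol of the language of set theory, the binary relation symbol `∈`. -/
inductive SetLangRel : ℕ → Type
  | mem : SetLangRel 2

/-- The language of set theory. -/
def setLang : FirstOrder.Language.{0, 0} where
  Functions := fun _ => Empty
  Relations := SetLangRel

/-- Every set `a` as the structure `(a, ∈)`. -/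
instance setLangStructure.{u} (a : ZFSet.{u}) : setLang.Structure a where
  funMap := fun f => Empty.elim f
  RelMap := fun {_} r => match r with
    | SetLangRel.mem => fun x => (x 0 : ZFSet.{u}) ∈ (x 1 : ZFSet.{u})

/-- `κ` is `η`-extendible: for some `ζ` there is an elementary embedding `j : V_{κ+η} → V_ζ` with
critical point `κ` and `η < j(κ)`. The element `c` is `κ` as an element of `V_{κ+η}`. -/
def IsExtendible.{u} (η : Ordinal.{u}) (κ : Cardinal.{u}) : Prop :=
  ∃ (ζ : Ordinal.{u})
    (j : FirstOrder.Language.ElementaryEmbedding setLang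
      (ZFSet.vonNeumann (κ.ord + η)) (ZFSet.vonNeumann ζ))
    (c : ZFSet.vonNeumann (κ.ord + η)),
    (c : ZFSet.{u}) = κ.ord.toZFSet ∧
    (∀ x : ZFSet.vonNeumann (κ.ord + η), (x : ZFSet.{u}) ∈ κ.ord.toZFSet →
      (j x : ZFSet.{u}) = x) ∧
    (j c : ZFSet.{u}) ≠ c ∧
    η.toZFSet ∈ (j c : ZFSet.{u})

universe u

open ZFSet

/-! Let `κ` reflect upwards. The structures isomorphic to some `(V_{o+1}, ∈)` form a class closed
under isomorphisms, and this class is `Σ₁^F(PwSt)`-definable already for `F = id`. Indeed, a set of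
levels of the cumulative hierarchy can be recognized by a `Δ₀` formula using the power set predicate
(`IsHistory.eq_vonNeumann`), and a witness consisting of the domain, the relation, `V_{o+1}`, its
levels and an isomorphism is hereditarily no larger than the code of the structure
(`exists_isLevelWitness`).

Reflection applied to `V_{a+1}` with `a = κ + n + 2` therefore gives an elementary `J : V_{a+1} →
V_{b+1}` with `b > a` (`exists_embedding`). As both structures are transitive and contain all
subsets of their elements, `J` preserves `Δ₀(PwSt)` formulas evaluated in the universe. Elements of
top rank go to elements of top rank, so `J` cannot fix every ordinal up to `a`.

Let `μ` be the least ordinal moved. It is a limit, hence `μ ≤ κ`, since only successors lie above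
`κ` and up to `κ + n + 2`. A bijection between `μ` and a smaller ordinal would contradict `μ < J μ`,
so `μ` is a cardinal. Finally `J` maps `V_{μ+n}` to some `V_ζ`, and satisfaction in a set is `Δ₀` in
that set (`exists_relativization`), so the restriction of `J` to `V_{μ+n}` is elementary and
witnesses that `μ` is `n`-extendible. -/

/-! ### Relations that are `Δ₀` in the power set predicate -/

/-- `f` is a projection: it reads off one of the variables. -/
def IsVar {n : ℕ} (f : (Fin n → ZFSet.{u}) → ZFSet.{u}) : Prop :=
  ∃ i, ∀ x, f x = x i

/-- The relation `P` is defined by a `Δ₀(PwSt)`-formula. -/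
def IsDelta0 {n : ℕ} (P : (Fin n → ZFSet.{u}) → Prop) : Prop :=
  ∃ φ : Delta0 2 n, ∀ x, φ.Holds PwSt x ↔ P x

namespace IsDelta0

variable {n : ℕ} {P Q : (Fin n → ZFSet.{u}) → Prop} {f g : (Fin n → ZFSet.{u}) → ZFSet.{u}}

theorem congr (h : IsDelta0 P) (e : ∀ x, Q x ↔ P x) : IsDelta0 Q := by
  obtain ⟨φ, hφ⟩ := h
  exact ⟨φ, fun x => (hφ x).trans (e x).symm⟩

theorem eq (hf : IsVar f) (hg : IsVar g) : IsDelta0 fun x => f x = g x := by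
  obtain ⟨i, hi⟩ := hf
  obtain ⟨j, hj⟩ := hg
  exact ⟨.eq i j, fun x => by simp [Delta0.Holds, hi, hj]⟩

theorem mem (hf : IsVar f) (hg : IsVar g) : IsDelta0 fun x => f x ∈ g x := by
  obtain ⟨i, hi⟩ := hf
  obtain ⟨j, hj⟩ := hg
  exact ⟨.mem i j, fun x => by simp [Delta0.Holds, hi, hj]⟩

theorem eq_powerset (hf : IsVar f) (hg : IsVar g) : IsDelta0 fun x => f x = powerset (g x) := by
  obtain ⟨i, hi⟩ := hf
  obtain ⟨j, hj⟩ := hg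
  exact ⟨.pred ![j, i], fun x => by simp [Delta0.Holds, PwSt, hi, hj]⟩

theorem not (hP : IsDelta0 P) : IsDelta0 fun x => ¬ P x := by
  obtain ⟨φ, hφ⟩ := hP
  exact ⟨.neg φ, fun x => by simp [Delta0.Holds, hφ]⟩

theorem and (hP : IsDelta0 P) (hQ : IsDelta0 Q) : IsDelta0 fun x => P x ∧ Q x := by
  obtain ⟨φ, hφ⟩ := hP
  obtain ⟨ψ, hψ⟩ := hQ
  exact ⟨.and φ ψ, fun x => by simp [Delta0.Holds, hφ, hψ]⟩

theorem or (hP : IsDelta0 P) (hQ : IsDelta0 Q) : IsDelta0 fun x => P x ∨ Q x :=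
  (hP.not.and hQ.not).not.congr fun x => by tauto

theorem imp (hP : IsDelta0 P) (hQ : IsDelta0 Q) : IsDelta0 fun x => P x → Q x :=
  (hP.and hQ.not).not.congr fun x => by tauto

theorem iff (hP : IsDelta0 P) (hQ : IsDelta0 Q) : IsDelta0 fun x => P x ↔ Q x :=
  ((hP.imp hQ).and (hQ.imp hP)).congr fun x => by tauto

/-- The bound variable is position `0` of the extended assignment and the old variables are its
tail. This is why operands pick up one `.tail` per enclosing quantifier below. -/
theorem ball (hf : IsVar f) {P : (Fin n → ZFSet.{u}) → ZFSet.{u} → Prop}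
    (hP : IsDelta0 fun x : Fin (n + 1) → ZFSet.{u} => P (Fin.tail x) (x 0)) :
    IsDelta0 fun x => ∀ z ∈ f x, P x z := by
  obtain ⟨i, hi⟩ := hf
  obtain ⟨φ, hφ⟩ := hP
  exact ⟨.ball i φ, fun x => by simp [Delta0.Holds, hφ, hi]⟩

theorem bex (hf : IsVar f) {P : (Fin n → ZFSet.{u}) → ZFSet.{u} → Prop}
    (hP : IsDelta0 fun x : Fin (n + 1) → ZFSet.{u} => P (Fin.tail x) (x 0)) :
    IsDelta0 fun x => ∃ z ∈ f x, P x z :=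
  (ball hf (P := fun x z => ¬ P x z) hP.not).not.congr fun x => by push Not; rfl

end IsDelta0

theorem IsVar.proj {n : ℕ} (i : Fin n) : IsVar fun x : Fin n → ZFSet.{u} => x i :=
  ⟨i, fun _ => rfl⟩

theorem IsVar.tail {n : ℕ} {f : (Fin n → ZFSet.{u}) → ZFSet.{u}} (hf : IsVar f) :
    IsVar fun x : Fin (n + 1) → ZFSet.{u} => f (Fin.tail x) := by
  obtain ⟨i, hi⟩ := hf
  exact ⟨i.succ, fun x => hi _⟩

namespace IsDelta0

variable {n : ℕ} {f g k : (Fin n → ZFSet.{u}) → ZFSet.{u}}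

theorem subset (hf : IsVar f) (hg : IsVar g) : IsDelta0 fun x => f x ⊆ g x :=
  (ball hf (P := fun x z => z ∈ g x) (mem (.proj 0) hg.tail)).congr fun _ => Iff.rfl

theorem eq_empty (hf : IsVar f) : IsDelta0 fun x => f x = ∅ :=
  (ball hf (P := fun _ z => ¬ z = z) (eq (.proj 0) (.proj 0)).not).congr fun x => by
    simp [ZFSet.eq_empty]

theorem eq_insert (hf : IsVar f) (hg : IsVar g) (hk : IsVar k) :
    IsDelta0 fun x => f x = insert (g x) (k x) :=
  ((ball hf (P := fun x z => z = g x ∨ z ∈ k x)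
    ((eq (.proj 0) hg.tail).or (mem (.proj 0) hk.tail))).and
    ((mem hg hf).and (subset hk hf))).congr fun x => by
      constructor
      · intro h
        rw [h]
        exact ⟨fun z hz => by simpa using hz, by simp, fun z hz => by simp [hz]⟩
      · rintro ⟨h₁, h₂, h₃⟩
        ext z
        rw [mem_insert_iff]
        refine ⟨h₁ z, ?_⟩
        rintro (rfl | h)
        exacts [h₂, h₃ h]

theorem eq_singleton (hf : IsVar f) (hg : IsVar g) : IsDelta0 fun x => f x = {g x} :=
  ((ball hf (P := fun x z => z = g x) (eq (.proj 0) hg.tail)).and (mem hg hf)).congr fun x => by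
    constructor
    · intro h
      rw [h]
      simp
    · rintro ⟨h₁, h₂⟩
      ext z
      rw [mem_singleton]
      refine ⟨h₁ z, ?_⟩
      rintro rfl
      exact h₂

theorem eq_unorderedPair (hf : IsVar f) (hg : IsVar g) (hk : IsVar k) :
    IsDelta0 fun x => f x = {g x, k x} :=
  ((ball hf (P := fun x z => z = g x ∨ z = k x)
    ((eq (.proj 0) hg.tail).or (eq (.proj 0) hk.tail))).and
    ((mem hg hf).and (mem hk hf))).congr fun x => by
      constructor
      · intro h
        rw [h]
        simp
      · rintro ⟨h₁, h₂, h₃⟩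
        ext z
        rw [ZFSet.mem_pair]
        refine ⟨h₁ z, ?_⟩
        rintro (rfl | rfl)
        exacts [h₂, h₃]

theorem eq_pair (hf : IsVar f) (hg : IsVar g) (hk : IsVar k) :
    IsDelta0 fun x => f x = pair (g x) (k x) :=
  ((ball hf (P := fun x z => z = {g x} ∨ z = {g x, k x})
    ((eq_singleton (.proj 0) hg.tail).or (eq_unorderedPair (.proj 0) hg.tail hk.tail))).and
    ((bex hf (P := fun x z => z = {g x}) (eq_singleton (.proj 0) hg.tail)).and
      (bex hf (P := fun x z => z = {g x, k x})
        (eq_unorderedPair (.proj 0) hg.tail hk.tail)))).congr fun x => by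
      constructor
      · intro h
        rw [h]
        simp [pair]
      · rintro ⟨h₁, ⟨z₂, h₂, e₂⟩, ⟨z₃, h₃, e₃⟩⟩
        ext z
        rw [pair, ZFSet.mem_pair]
        refine ⟨h₁ z, ?_⟩
        rintro (rfl | rfl)
        exacts [e₂ ▸ h₂, e₃ ▸ h₃]

theorem pair_mem (hf : IsVar f) (hg : IsVar g) (hk : IsVar k) :
    IsDelta0 fun x => pair (f x) (g x) ∈ k x :=
  (bex hk (P := fun x z => z = pair (f x) (g x)) (eq_pair (.proj 0) hf.tail hg.tail)).congr
    fun x => by simp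

theorem isTransitive (hf : IsVar f) : IsDelta0 fun x => (f x).IsTransitive :=
  (ball hf (P := fun x z => z ⊆ f x) (subset (.proj 0) hf.tail)).congr fun _ => Iff.rfl

theorem isOrdinal (hf : IsVar f) : IsDelta0 fun x => (f x).IsOrdinal :=
  ((isTransitive hf).and (ball hf (P := fun _ z => z.IsTransitive) (isTransitive (.proj 0)))).congr
    fun x => by
      rw [isOrdinal_iff_forall_mem_isTransitive]

end IsDelta0

/-! ### Sets of levels of the cumulative hierarchy -/

/-- Every member of `h` is the union of the power sets of those members of `h` that it contains,
and these power sets belong to `h`. -/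
def IsHistory (h : ZFSet.{u}) : Prop :=
  ∀ v ∈ h, (∀ x ∈ v, ∃ w ∈ h, w ∈ v ∧ x ⊆ w) ∧
    ∀ w ∈ h, w ∈ v → ∃ p ∈ h, p = powerset w ∧ p ⊆ v

/-- By `∈`-induction: a set `x` of rank below that of `v` has rank at most that of some `y ∈ v`;
this `y` is included in a member `w` of `v` that is a level by induction, so `x ⊆ w` and `x ∈ 𝒫(w) ⊆
v`. All quantifiers in `IsHistory` are bounded, so levels become recognizable by `Δ₀(PwSt)`
formulas. -/
theorem IsHistory.eq_vonNeumann {h : ZFSet.{u}} (hh : IsHistory h) (v : ZFSet.{u}) :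
    v ∈ h → v = V_ v.rank := by
  induction v using ZFSet.inductionOn with
  | _ v ih =>
    intro hv
    obtain ⟨h₁, h₂⟩ := hh v hv
    refine le_antisymm (subset_vonNeumann_self v) ?_
    intro x hx
    obtain ⟨y, hy, hxy⟩ := lt_rank_iff.1 (mem_vonNeumann.1 hx)
    obtain ⟨w, hw, hwv, hyw⟩ := h₁ y hy
    obtain ⟨p, -, rfl, hpv⟩ := h₂ w hw hwv
    refine hpv (mem_powerset.2 ?_)
    rw [ih w hwv hw, subset_vonNeumann]
    exact hxy.trans (rank_mono hyw)

/-- The set of all levels of the cumulative hierarchy up to `V_ o`. -/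
noncomputable def levels (o : Ordinal.{u}) : ZFSet.{u} :=
  ZFSet.sep (fun z => z = V_ z.rank) (V_ (o + 1))

theorem mem_levels {o : Ordinal.{u}} {z : ZFSet.{u}} : z ∈ levels o ↔ ∃ a ≤ o, z = V_ a := by
  rw [levels, mem_sep, mem_vonNeumann, Order.lt_add_one_iff]
  constructor
  · rintro ⟨h₁, h₂⟩
    exact ⟨_, h₁, h₂⟩
  · rintro ⟨a, ha, rfl⟩
    simpa using ha

theorem isHistory_levels (o : Ordinal.{u}) : IsHistory (levels o) := by
  intro v hv
  obtain ⟨a, ha, rfl⟩ := mem_levels.1 hv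
  constructor
  · intro x hx
    have hx := mem_vonNeumann.1 hx
    exact ⟨V_ x.rank, mem_levels.2 ⟨_, hx.le.trans ha, rfl⟩, by simpa using hx,
      subset_vonNeumann_self x⟩
  · intro w hw hwv
    obtain ⟨b, hb, rfl⟩ := mem_levels.1 hw
    have hba : b < a := by simpa using hwv
    refine ⟨V_ (b + 1), mem_levels.2 ⟨_, ?_, rfl⟩, vonNeumann_add_one b, ?_⟩
    · exact (Order.add_one_le_of_lt hba).trans ha
    · exact vonNeumann_subset_of_le (Order.add_one_le_of_lt hba)

theorem IsDelta0.isHistory {n : ℕ} {f : (Fin n → ZFSet.{u}) → ZFSet.{u}} (hf : IsVar f) :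
    IsDelta0 fun x => IsHistory (f x) := by
  refine .ball hf (.and (.ball (.proj 0) ?_) (.ball hf.tail ?_))
  · exact .bex hf.tail.tail (.and (.mem (.proj 0) (IsVar.proj 0).tail.tail)
      (.subset (IsVar.proj 0).tail (.proj 0)))
  · exact .imp (.mem (.proj 0) (IsVar.proj 0).tail) (.bex hf.tail.tail (.and
      (.eq_powerset (.proj 0) (IsVar.proj 0).tail) (.subset (.proj 0) (IsVar.proj 0).tail.tail)))

/-! ### Levels of the cumulative hierarchy as structures -/

namespace LevelStr

/-- The only sort. -/
def sort : ({∅} : ZFSet.{u}) := ⟨∅, by simp⟩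

instance : Subsingleton ({∅} : ZFSet.{u}) :=
  ⟨fun a b => Subtype.ext ((mem_singleton.1 a.2).trans (mem_singleton.1 b.2).symm)⟩

instance : IsEmpty (∅ : ZFSet.{u}) :=
  ⟨fun a => notMem_empty _ a.2⟩

/-- The vocabulary with one sort and one binary relation symbol. -/
def vocab : SetVocab.{u} where
  sorts := {∅}
  rels := {∅}
  funs := ∅
  relArgs := fun _ => [sort, sort]
  funArgs := fun _ => []
  funOut := fun _ => sort

/-- The structure `(V_ (o + 1), ∈)`. -/
noncomputable def str (o : Ordinal.{u}) : SetStr vocab.{u} where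
  dom := fun _ => V_ (o + 1)
  nonempty := fun _ => ⟨V_ o, by simp⟩
  rel := fun _ x => (x (0 : Fin 2) : ZFSet.{u}) ∈ (x (1 : Fin 2) : ZFSet.{u})
  func := fun f => (notMem_empty _ f.2).elim

/-- Isomorphisms onto `(V_ (o + 1), ∈)`. -/
def IsIso (M : MSStr.{u + 1, u + 1} vocab.{u}.lang) (o : Ordinal.{u})
    (e : (s : vocab.{u}.sorts) → M.Dom s ≃ V_ (o + 1)) : Prop :=
  ∀ r x, M.rel r x ↔ (e sort (x (0 : Fin 2)) : ZFSet.{u}) ∈ (e sort (x (1 : Fin 2)) : ZFSet.{u})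

/-- The relation `P`, which may depend on the level, is uniformly first-order definable. -/
def IsFO (Γ : List vocab.{u}.sorts)
    (P : Ordinal.{u} → (Fin Γ.length → ZFSet.{u}) → Prop) : Prop :=
  ∃ ψ : MSFormula vocab.lang Γ, ∀ M o e, IsIso M o e → ∀ x : SortedTuple M.Dom Γ,
    ψ.Sat M x ↔ P o fun i => (e _ (x i) : ZFSet.{u})

/-- The sort at position `i` equals `s` only propositionally, so a variable has to be transported
before it can serve as a term of sort `s`. -/
theorem exists_term (Γ : List vocab.{u}.sorts) (s : vocab.{u}.sorts) (i : Fin Γ.length) :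
    ∃ t : MSTerm vocab.lang Γ s, ∀ (M : MSStr.{u + 1, u + 1} vocab.{u}.lang) (o : Ordinal.{u})
      (e : (s : vocab.{u}.sorts) → M.Dom s ≃ V_ (o + 1)) (x : SortedTuple M.Dom Γ),
      e s (t.eval M x) = e _ (x i) := by
  obtain rfl : Γ.get i = s := @Subsingleton.elim ({∅} : ZFSet.{u}) _ _ _
  exact ⟨.var (L := vocab.lang) i, fun M o e x => rfl⟩

namespace IsFO

variable {Γ : List vocab.{u}.sorts} {P Q : Ordinal.{u} → (Fin Γ.length → ZFSet.{u}) → Prop}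

theorem congr (hP : IsFO Γ P)
    (h : ∀ o x, (∀ i, x i ∈ V_ (o + 1)) → (Q o x ↔ P o x)) : IsFO Γ Q := by
  obtain ⟨ψ, hψ⟩ := hP
  exact ⟨ψ, fun M o e he x => (hψ M o e he x).trans (h o _ fun i => (e _ (x i)).2).symm⟩

theorem eq (i j : Fin Γ.length) : IsFO Γ fun _ x => x i = x j := by
  obtain ⟨s, hs⟩ := exists_term Γ sort i
  obtain ⟨t, ht⟩ := exists_term Γ sort j
  refine ⟨.eq sort s t, fun M o e he x => ?_⟩
  exact (e sort).injective.eq_iff.symm.trans (Subtype.coe_inj.symm.trans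
    (iff_of_eq (congrArg₂ (fun a b : V_ (o + 1) => (a : ZFSet.{u}) = b) (hs M o e x)
      (ht M o e x))))

theorem mem (i j : Fin Γ.length) : IsFO Γ fun _ x => x i ∈ x j := by
  obtain ⟨s, hs⟩ := exists_term Γ sort i
  obtain ⟨t, ht⟩ := exists_term Γ sort j
  refine ⟨.rel (L := vocab.lang) (sort : vocab.rels)
    (Fin.cons s (Fin.cons t finZeroElim) : (i : Fin 2) → _), fun M o e he x => ?_⟩
  exact (he _ _).trans (iff_of_eq (congrArg₂ (fun a b : V_ (o + 1) =>
    (a : ZFSet.{u}) ∈ (b : ZFSet.{u}))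
    (hs M o e x) (ht M o e x)))

theorem not (hP : IsFO Γ P) : IsFO Γ fun o x => ¬ P o x := by
  obtain ⟨ψ, hψ⟩ := hP
  exact ⟨.neg ψ, fun M o e he x => not_congr (hψ M o e he x)⟩

theorem and (hP : IsFO Γ P) (hQ : IsFO Γ Q) : IsFO Γ fun o x => P o x ∧ Q o x := by
  obtain ⟨ψ, hψ⟩ := hP
  obtain ⟨χ, hχ⟩ := hQ
  exact ⟨.and ψ χ, fun M o e he x => and_congr (hψ M o e he x) (hχ M o e he x)⟩

theorem imp (hP : IsFO Γ P) (hQ : IsFO Γ Q) : IsFO Γ fun o x => P o x → Q o x :=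
  (hP.and hQ.not).not.congr fun o x _ => by tauto

theorem iff (hP : IsFO Γ P) (hQ : IsFO Γ Q) : IsFO Γ fun o x => P o x ↔ Q o x :=
  ((hP.imp hQ).and (hQ.imp hP)).congr fun o x _ => by tauto

theorem all {P : Ordinal.{u} → (Fin Γ.length → ZFSet.{u}) → ZFSet.{u} → Prop}
    (hP : IsFO (sort :: Γ) fun o x => P o (Fin.tail x) (x 0)) :
    IsFO Γ fun o x => ∀ z ∈ V_ (o + 1), P o x z := by
  obtain ⟨ψ, hψ⟩ := hP
  refine ⟨.all (L := vocab.lang) sort ψ, fun M o e he x => ?_⟩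
  have key (a : M.Dom sort) : ψ.Sat M (SortedTuple.cons a x) ↔
      P o (fun i => (e _ (x i) : ZFSet.{u})) (e sort a) := hψ M o e he _
  constructor
  · intro h z hz
    have := (key ((e sort).symm ⟨z, hz⟩)).1 (h _)
    simpa using this
  · intro h a
    exact (key a).2 (h _ (e sort a).2)

end IsFO

/-- A `Δ₀(PwSt)`-formula has the same meaning in a level of the cumulative hierarchy. -/
theorem isFO_holds {m : ℕ} (φ : Delta0 2 m) : ∀ (Γ : List vocab.{u}.sorts)
    (v : Fin m → Fin Γ.length), IsFO Γ fun _ x => φ.Holds PwSt fun i => x (v i) := by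
  induction φ with
  | eq i j => exact fun Γ v => .eq _ _
  | mem i j => exact fun Γ v => .mem _ _
  | neg φ ih => exact fun Γ v => (ih Γ v).not
  | and φ ψ ih₁ ih₂ => exact fun Γ v => (ih₁ Γ v).and (ih₂ Γ v)
  | pred l =>
    intro Γ v
    -- `y = 𝒫(x)` is expressed by comparing membership in `y` with inclusion in `x`, for sets `z` of
    -- the structure only. This is faithful because `V_{o+1}` is transitive and contains every
    -- subset of each of its elements.
    refine IsFO.congr (IsFO.all (P := fun o x z => z ∈ x (v (l 1)) ↔
      ∀ w ∈ V_ (o + 1), w ∈ z → w ∈ x (v (l 0)))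
      (.iff (.mem (Γ := sort :: Γ) (0 : Fin (Γ.length + 1)) (v (l 1)).succ)
      (.all (Γ := sort :: Γ)
        (P := fun _ x w => w ∈ x (0 : Fin (Γ.length + 1)) → w ∈ x (v (l 0)).succ)
        (.imp (.mem (Γ := sort :: sort :: Γ) (0 : Fin (Γ.length + 2)) (1 : Fin (Γ.length + 2)))
          (.mem (Γ := sort :: sort :: Γ) (0 : Fin (Γ.length + 2)) (v (l 0)).succ.succ))))) ?_
    intro o x hx
    have hV {w z : ZFSet.{u}} (hz : z ∈ V_ (o + 1)) (hw : w ∈ z) : w ∈ V_ (o + 1) :=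
      isTransitive_vonNeumann _ z hz hw
    simp only [Delta0.Holds, PwSt]
    constructor
    · intro h z hz
      rw [h, mem_powerset]
      exact ⟨fun h w _ hw => h hw, fun h w hw => h w (hV hz hw) hw⟩
    · intro h
      ext z
      rw [mem_powerset]
      constructor
      · intro hz w hw
        exact (h z (hV (hx _) hz)).1 hz w (hV (hV (hx _) hz) hw) hw
      · intro hz
        exact (h z (mem_vonNeumann_of_subset hz (hx _))).2 fun w _ hw => hz hw
  | ball i φ ih =>
    intro Γ v
    refine IsFO.congr (IsFO.all (P := fun o x z => z ∈ x (v i) →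
      φ.Holds PwSt (Fin.cons z fun i => x (v i)))
      (.imp (.mem (Γ := sort :: Γ) (0 : Fin (Γ.length + 1)) (v i).succ) (.congr (ih (sort :: Γ)
        (Fin.cons (0 : Fin (Γ.length + 1)) fun i => (v i).succ)) ?_))) ?_
    · intro o x _
      refine iff_of_eq (congrArg _ (funext fun j => ?_))
      cases j using Fin.cases <;> rfl
    · intro o x hx
      exact ⟨fun h z _ hz => h z hz,
        fun h z hz => h z (isTransitive_vonNeumann _ _ (hx _) hz) hz⟩

end LevelStr

/-! ### Relativization of first-order formulas -/

/-- Quantifiers over the structure `(x w, ∈)` become quantifiers bounded by the variable `w`. Hence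
preservation of `Δ₀` formulas alone yields full elementarity on every set in the domain of a map. -/
theorem exists_relativization {m k : ℕ} (φ : setLang.BoundedFormula (Fin m) k) :
    ∀ {n : ℕ} (w : Fin n) (v : Fin m → Fin n) (v' : Fin k → Fin n),
    ∃ ψ : Delta0 2 n, ∀ (x : Fin n → ZFSet.{u}) (h : ∀ i, x (v i) ∈ x w)
      (h' : ∀ i, x (v' i) ∈ x w),
      ψ.Holds PwSt x ↔ φ.Realize (M := x w) (fun i => ⟨x (v i), h i⟩)
        (fun i => ⟨x (v' i), h' i⟩) := by
  have term {k : ℕ} (t : setLang.Term (Fin m ⊕ Fin k)) : ∃ i, t = .var i := by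
    cases t with
    | var i => exact ⟨i, rfl⟩
    | func f => exact f.elim
  have val {k n : ℕ} (w : Fin n) (v : Fin m → Fin n) (v' : Fin k → Fin n) (x : Fin n → ZFSet.{u})
      (h : ∀ i, x (v i) ∈ x w) (h' : ∀ i, x (v' i) ∈ x w) (i : Fin m ⊕ Fin k) :
      ((Sum.elim (fun i => (⟨x (v i), h i⟩ : x w)) (fun i => ⟨x (v' i), h' i⟩) i : x w) :
        ZFSet.{u}) = x (Sum.elim v v' i) := by
    cases i <;> rfl
  induction φ with
  | falsum =>
    exact fun w v v' => ⟨.neg (.eq w w), fun x h h' => by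
      simp [Delta0.Holds, FirstOrder.Language.BoundedFormula.Realize]⟩
  | equal t₁ t₂ =>
    intro n w v v'
    obtain ⟨i, rfl⟩ := term t₁
    obtain ⟨j, rfl⟩ := term t₂
    refine ⟨.eq (Sum.elim v v' i) (Sum.elim v v' j), fun x h h' => ?_⟩
    simp only [Delta0.Holds, FirstOrder.Language.BoundedFormula.Realize,
      FirstOrder.Language.Term.realize_var]
    rw [← Subtype.coe_inj, val, val]
  | rel R ts =>
    intro n w v v'
    cases R
    obtain ⟨i, hi⟩ := term (ts 0)
    obtain ⟨j, hj⟩ := term (ts 1)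
    refine ⟨.mem (Sum.elim v v' i) (Sum.elim v v' j), fun x h h' => ?_⟩
    simp only [Delta0.Holds, FirstOrder.Language.BoundedFormula.Realize,
      FirstOrder.Language.Structure.RelMap]
    rw [hi, hj, FirstOrder.Language.Term.realize_var, FirstOrder.Language.Term.realize_var,
      val, val]
  | imp φ ψ ih₁ ih₂ =>
    intro n w v v'
    obtain ⟨φ', h₁⟩ := ih₁ w v v'
    obtain ⟨ψ', h₂⟩ := ih₂ w v v'
    refine ⟨.neg (.and φ' (.neg ψ')), fun x h h' => ?_⟩
    simp only [Delta0.Holds, h₁ x h h', h₂ x h h',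
      FirstOrder.Language.BoundedFormula.Realize]
    tauto
  | all φ ih =>
    intro n w v v'
    -- `BoundedFormula` appends the new variable as the last one, `Delta0` puts it at position `0`.
    obtain ⟨φ', hφ⟩ := ih w.succ (fun i => (v i).succ) (Fin.snoc (fun i => (v' i).succ) 0)
    refine ⟨.ball w φ', fun x h h' => ?_⟩
    simp only [Delta0.Holds, FirstOrder.Language.BoundedFormula.Realize, Subtype.forall]
    refine forall₂_congr fun z hz => ?_
    refine (hφ (Fin.cons z x) (fun i => h i) (fun i => ?_)).trans (iff_of_eq ?_)
    · cases i using Fin.lastCases with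
      | last => simpa using hz
      | cast i => simpa using h' i
    · refine congrArg _ (funext fun i => Subtype.ext ?_)
      cases i using Fin.lastCases with
      | last => simp
      | cast i => simp

/-! ### Definable terms -/

/-- The graph of `G` is `Δ₀(PwSt)`-definable, also after substituting variables. -/
structure IsDelta0Term {n : ℕ} (G : (Fin n → ZFSet.{u}) → ZFSet.{u}) : Prop where
  graph : ∀ {m : ℕ} (ρ : (Fin m → ZFSet.{u}) → Fin n → ZFSet.{u}), (∀ i, IsVar fun x => ρ x i) →
    ∀ f : (Fin m → ZFSet.{u}) → ZFSet.{u}, IsVar f → IsDelta0 fun x => f x = G (ρ x)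

namespace IsDelta0Term

variable {n : ℕ} {G K : (Fin n → ZFSet.{u}) → ZFSet.{u}}

theorem of_isVar (h : IsVar G) : IsDelta0Term G := by
  obtain ⟨i, hi⟩ := h
  refine ⟨fun {m} ρ hρ f hf => ?_⟩
  exact (IsDelta0.eq hf (hρ i)).congr fun x => by rw [hi]

theorem empty : IsDelta0Term fun _ : Fin n → ZFSet.{u} => ∅ :=
  ⟨fun _ _ _ hf => IsDelta0.eq_empty hf⟩

theorem singleton (hG : IsDelta0Term G) : IsDelta0Term fun x => {G x} := by
  refine ⟨fun {m} ρ hρ f hf => ?_⟩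
  refine (IsDelta0.bex hf (P := fun x a => a = G (ρ x) ∧ f x = {a})
    (.and (hG.graph (fun x => ρ (Fin.tail x)) (fun i => (hρ i).tail) _ (.proj 0))
      (.eq_singleton hf.tail (.proj 0)))).congr fun x => ?_
  constructor
  · intro h
    rw [h]
    simp
  · rintro ⟨a, -, rfl, h⟩
    exact h

theorem pair (hG : IsDelta0Term G) (hK : IsDelta0Term K) :
    IsDelta0Term fun x => ZFSet.pair (G x) (K x) := by
  refine ⟨fun {m} ρ hρ f hf => ?_⟩
  -- Both components of a Kuratowski pair are elements of its elements, so they are reached from `f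
  -- x` by bounded quantifiers.
  refine (IsDelta0.bex hf (P := fun x q => ∃ a ∈ q, ∃ r ∈ f x, ∃ b ∈ r, a = G (ρ x) ∧
    b = K (ρ x) ∧ f x = ZFSet.pair a b) (.bex (.proj 0) (.bex hf.tail.tail (.bex (.proj 0)
      (.and (hG.graph (fun x => ρ (Fin.tail (Fin.tail (Fin.tail (Fin.tail x)))))
        (fun i => (hρ i).tail.tail.tail.tail) _ (IsVar.proj 0).tail.tail)
      (.and (hK.graph (fun x => ρ (Fin.tail (Fin.tail (Fin.tail (Fin.tail x)))))
        (fun i => (hρ i).tail.tail.tail.tail) _ (.proj 0))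
        (.eq_pair hf.tail.tail.tail.tail (IsVar.proj 0).tail.tail (.proj 0)))))))).congr
          fun x => ?_
  constructor
  · intro h
    rw [h]
    exact ⟨{G (ρ x)}, by simp [ZFSet.pair], _, by simp, {G (ρ x), K (ρ x)}, by simp [ZFSet.pair],
      _, by simp, rfl, rfl, rfl⟩
  · rintro ⟨_, _, a, _, _, _, b, _, rfl, rfl, h⟩
    exact h

theorem eq (hG : IsDelta0Term G) {f : (Fin n → ZFSet.{u}) → ZFSet.{u}} (hf : IsVar f) :
    IsDelta0 fun x => f x = G x :=
  hG.graph (fun x => x) (fun i => .proj i) f hf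

theorem mem (hG : IsDelta0Term G) {f : (Fin n → ZFSet.{u}) → ZFSet.{u}} (hf : IsVar f) :
    IsDelta0 fun x => G x ∈ f x :=
  (IsDelta0.bex hf (P := fun x z => z = G x)
    (hG.graph Fin.tail (fun i => (IsVar.proj i).tail) _ (.proj 0))).congr fun x => by simp

end IsDelta0Term

/-! ### Bounds for the `H`-rank -/

namespace ZFSet

open Cardinal

variable {x y z t : ZFSet.{u}} {c : Cardinal.{u}}

theorem hRank_le_of_subset (hc : ℵ₀ ≤ c) (ht : t.IsTransitive) (hx : x ⊆ t) (h : t.card ≤ c) :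
    x.hRank ≤ c :=
  max_le hc ((card_mono fun _ hz => mem_trcl.1 hz t ht hx).trans h)

theorem card_le_hRank (x : ZFSet.{u}) : x.card ≤ x.hRank :=
  (card_mono (subset_trcl x)).trans (le_max_right _ _)

theorem hRank_le_of_mem (h : z ∈ x) : z.hRank ≤ x.hRank :=
  hRank_le_of_subset (le_max_left _ _) (isTransitive_trcl x)
    (isTransitive_trcl x _ (subset_trcl x h)) (le_max_right _ _)

theorem hRank_le_of_forall (hc : ℵ₀ ≤ c) (hy : y.card ≤ c) (h : ∀ z ∈ y, z.hRank ≤ c) :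
    y.hRank ≤ c := by
  -- This superset of `y` is transitive, and it has at most `c` elements as a union of at most `c`
  -- sets of size at most `c`.
  refine hRank_le_of_subset hc (t := y ∪ ⋃ z : y, trcl z) ?_ (fun z hz => by simp [hz]) ?_
  · intro z hz w hw
    rw [mem_union, mem_iUnion] at hz ⊢
    right
    rcases hz with hz | ⟨v, hv⟩
    · exact ⟨⟨z, hz⟩, subset_trcl z hw⟩
    · exact ⟨v, isTransitive_trcl _ _ hv hw⟩
  · refine card_union_le.trans (add_le_of_le hc hy ?_)
    rw [← lift_le.{u + 1}]
    refine lift_card_iUnion_le_sum_card.trans ?_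
    refine (sum_le_sum _ (fun _ => c) fun z : y =>
      (le_max_right _ _).trans (h z z.2)).trans ?_
    rw [sum_const, cardinalMk_coe_sort, Cardinal.lift_id'.{u, u + 1}]
    rw [← lift_mul, lift_le]
    exact mul_le_of_le hc hy le_rfl

theorem hRank_insert_le (hc : ℵ₀ ≤ c) (hx : x.hRank ≤ c) (hy : y.hRank ≤ c) :
    (insert x y : ZFSet.{u}).hRank ≤ c := by
  refine hRank_le_of_forall hc ?_ ?_
  · exact card_insert_le.trans (add_le_of_le hc ((card_le_hRank y).trans hy)
      (one_le_aleph0.trans hc))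
  · intro z hz
    rcases mem_insert_iff.1 hz with rfl | hz
    exacts [hx, (hRank_le_of_mem hz).trans hy]

theorem hRank_empty_le (hc : ℵ₀ ≤ c) : (∅ : ZFSet.{u}).hRank ≤ c :=
  hRank_le_of_forall hc (by simp) (by simp)

theorem hRank_singleton_le (hc : ℵ₀ ≤ c) (hx : x.hRank ≤ c) : ({x} : ZFSet.{u}).hRank ≤ c :=
  hRank_le_of_forall hc (by simpa using one_le_aleph0.trans hc) (by simpa using hx)

theorem hRank_pair_le (hc : ℵ₀ ≤ c) (hx : x.hRank ≤ c) (hy : y.hRank ≤ c) :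
    (pair x y).hRank ≤ c :=
  hRank_insert_le hc (hRank_singleton_le hc hx)
    (hRank_singleton_le hc (hRank_insert_le hc hx (hRank_singleton_le hc hy)))

theorem hRank_le_singleton (x : ZFSet.{u}) : x.hRank ≤ ({x} : ZFSet.{u}).hRank :=
  hRank_le_of_mem (by simp)

theorem hRank_left_le_pair (x y : ZFSet.{u}) : x.hRank ≤ (pair x y).hRank :=
  (hRank_le_singleton x).trans (hRank_le_of_mem (by simp [pair]))

theorem hRank_right_le_pair (x y : ZFSet.{u}) : y.hRank ≤ (pair x y).hRank :=
  (hRank_le_of_mem (x := {x, y}) (by simp)).trans (hRank_le_of_mem (by simp [pair]))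

end ZFSet

/-! ### The identity is definably bounding -/

/-- The vocabulary with two sorts and a function symbol between them. -/
def injLang : MSLang.{u} where
  S := ULift Bool
  R := PEmpty
  F := PUnit
  relArgs := fun _ => []
  funArgs := fun _ => [⟨true⟩]
  funOut := fun _ => ⟨false⟩

/-- The sentence says that the function symbol is an injection from sort `b` to sort `a`. There are
no further sorts, so a model has exactly `|A| + |B|` elements. -/
theorem isDefinablyBounding_id : IsDefinablyBounding.{u} id := by
  let b : injLang.{u}.S := ⟨true⟩
  let a : injLang.{u}.S := ⟨false⟩
  let v₀ : MSTerm injLang.{u} [b, b] b := .var (L := injLang.{u}) (Γ := [b, b]) (0 : Fin 2)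
  let v₁ : MSTerm injLang.{u} [b, b] b := .var (L := injLang.{u}) (Γ := [b, b]) (1 : Fin 2)
  let φ : MSFormula injLang.{u} [] := .all b (.all b (.neg (.and
    (.eq a (.app PUnit.unit (Fin.cons v₀ finZeroElim : (i : Fin 1) → _))
      (.app PUnit.unit (Fin.cons v₁ finZeroElim : (i : Fin 1) → _))) (.neg (.eq b v₀ v₁)))))
  let fn (M : MSStr.{u, u} injLang.{u}) (z : M.Dom b) : M.Dom a :=
    M.func PUnit.unit (Fin.cons z finZeroElim : (i : Fin 1) → _)
  have fn_eq (M : MSStr.{u, u} injLang.{u}) (t : SortedTuple M.Dom [b]) :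
      M.func PUnit.unit t = fn M (t (0 : Fin 1)) := by
    refine congrArg (M.func PUnit.unit) (funext fun i => ?_)
    change Fin 1 at i
    obtain rfl := Subsingleton.elim i 0
    rfl
  have hφ (M : MSStr.{u, u} injLang.{u}) : M.Models φ ↔ Function.Injective (fn M) := by
    have : M.Models φ ↔ ∀ p q : M.Dom b, ¬ (fn M q = fn M p ∧ ¬ q = p) := by
      refine forall₂_congr fun p q => not_congr (and_congr ?_ Iff.rfl)
      exact iff_of_eq (congrArg₂ (fun y z : M.Dom a => y = z) (fn_eq M _) (fn_eq M _))
    rw [this]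
    exact ⟨fun h p q e => by_contra fun hn => h q p ⟨e, hn⟩, fun h p q e => e.2 (h e.1)⟩
  refine ⟨monotone_id, injLang, a, b, φ, fun h => Bool.noConfusion (congrArg ULift.down h), ?_, ?_⟩
  · intro A B hA hB
    constructor
    · intro h
      obtain ⟨g⟩ := Cardinal.le_def _ _ |>.1 h
      refine ⟨⟨fun s => match s with | ⟨true⟩ => B | ⟨false⟩ => A, ?_, fun r => r.elim,
        fun _ t => g (t (0 : Fin 1))⟩, ?_, ⟨Equiv.refl _⟩, ⟨Equiv.refl _⟩⟩
      · rintro ⟨_ | _⟩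
        exacts [hA, hB]
      · rw [hφ]
        exact g.injective
    · rintro ⟨M, hM, ⟨e⟩, ⟨f⟩⟩
      exact Cardinal.mk_le_of_injective
        (e.injective.comp (((hφ M).1 hM).comp f.symm.injective))
  · intro A B _ _
    refine ⟨Cardinal.mk (A ⊕ B), fun M _ ⟨e⟩ ⟨f⟩ => ?_⟩
    refine Cardinal.mk_le_of_injective (f := fun z => match z with
      | ⟨⟨true⟩, z⟩ => Sum.inr (f z)
      | ⟨⟨false⟩, z⟩ => Sum.inl (e z)) ?_
    rintro ⟨⟨_ | _⟩, z⟩ ⟨⟨_ | _⟩, w⟩ h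
    · rw [e.injective (Sum.inl_injective h)]
    · exact (Sum.inl_ne_inr h).elim
    · exact (Sum.inr_ne_inl h).elim
    · rw [f.injective (Sum.inr_injective h)]

/-! ### Codes over singleton and empty index sets -/

theorem ZFSet.range_singleton {a : ZFSet.{u}} (f : ({a} : ZFSet.{u}) → ZFSet.{u}) :
    ZFSet.range f = {f ⟨a, by simp⟩} := by
  ext z
  rw [mem_range, mem_singleton]
  constructor
  · rintro ⟨⟨i, hi⟩, rfl⟩
    obtain rfl := mem_singleton.1 hi
    rfl
  · rintro rfl
    exact ⟨_, rfl⟩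

theorem ZFSet.range_empty (f : (∅ : ZFSet.{u}) → ZFSet.{u}) : ZFSet.range f = ∅ := by
  rw [ZFSet.eq_empty]
  intro z hz
  obtain ⟨i, -⟩ := mem_range.1 hz
  exact notMem_empty _ i.2

/-- The interpretation of a relation symbol as a set of tuples. -/
noncomputable def SetStr.relSet {τ : SetVocab.{u}} (A : SetStr τ) (r : τ.rels) : ZFSet.{u} :=
  ZFSet.range fun x : {x : SortedTuple (fun s => A.dom s) (τ.relArgs r) // A.rel r x} =>
    A.tupleCode x.1

namespace LevelStr

/-! ### Codes of structures with one binary relation -/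

theorem code_vocab : vocab.{u}.code =
    pair {∅} (pair {pair ∅ (pair ∅ (pair ∅ ∅))} (pair ∅ ∅)) := by
  refine congrArg₂ pair rfl (congrArg₂ pair ?_ (congrArg₂ pair ?_ rfl))
  · exact ZFSet.range_singleton _
  · exact ZFSet.range_empty _

/-- The binary relation of a structure as a set of tuples. -/
noncomputable def relSet (A : SetStr vocab.{u}) : ZFSet.{u} :=
  A.relSet sort

/-- The code of a structure with domain `D` and binary relation `E`. -/
noncomputable def relCode (D E : ZFSet.{u}) : ZFSet.{u} :=
  pair {pair ∅ D} (pair {pair ∅ E} (pair ∅ ∅))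

theorem code_eq (A : SetStr vocab.{u}) : A.code = relCode (A.dom sort) (relSet A) := by
  refine congrArg₂ pair ?_ (congrArg₂ pair ?_ (congrArg₂ pair ?_ rfl))
  · exact ZFSet.range_singleton _
  · exact ZFSet.range_singleton _
  · exact ZFSet.range_empty _

/-- Pairs of elements as arguments of the relation symbol. -/
def args {D : vocab.{u}.sorts → Type (u + 1)} (a b : D sort) : SortedTuple D [sort, sort] :=
  (Fin.cons a (Fin.cons b finZeroElim) : (i : Fin 2) → _)

theorem args_eta {D : vocab.{u}.sorts → Type (u + 1)} (x : SortedTuple D [sort, sort]) :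
    args (x (0 : Fin 2)) (x (1 : Fin 2)) = x := by
  funext i
  change Fin 2 at i
  fin_cases i <;> rfl

theorem mem_relSet {A : SetStr vocab.{u}} {z : ZFSet.{u}} : z ∈ relSet A ↔
    ∃ a b : A.dom sort, A.rel sort (args a b) ∧ z = pair a (pair b ∅) := by
  refine mem_range.trans ?_
  constructor
  · rintro ⟨⟨x, hx⟩, rfl⟩
    refine ⟨x (0 : Fin 2), x (1 : Fin 2), ?_, rfl⟩
    exact (congrArg (A.rel sort) (args_eta x)).mpr hx
  · rintro ⟨a, b, h, rfl⟩
    exact ⟨⟨_, h⟩, rfl⟩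

theorem pair_mem_relSet {A : SetStr vocab.{u}} {a b : A.dom sort} :
    pair (a : ZFSet.{u}) (pair b ∅) ∈ relSet A ↔ A.rel sort (args a b) := by
  rw [mem_relSet]
  constructor
  · rintro ⟨c, d, h, e⟩
    obtain ⟨e₁, e₂⟩ := pair_inj.1 e
    obtain rfl := Subtype.ext e₁
    obtain rfl := Subtype.ext (pair_inj.1 e₂).1
    exact h
  · exact fun h => ⟨a, b, h, rfl⟩

/-- The structure with domain `D` and binary relation `E`. -/
def ofRel (D E : ZFSet.{u}) (hD : D.Nonempty) : SetStr vocab.{u} where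
  dom := fun _ => D
  nonempty := fun _ => hD
  rel := fun _ x => pair (x (0 : Fin 2)) (pair (x (1 : Fin 2)) ∅) ∈ E
  func := fun f => (notMem_empty _ f.2).elim

/-- Elements of `E` that do not code pairs over `D` would be lost when passing to the structure;
`hE` excludes them, and `IsLevelWitness` contains the same clause for this reason. -/
theorem code_ofRel {D E : ZFSet.{u}} (hD : D.Nonempty)
    (hE : ∀ z ∈ E, ∃ a ∈ D, ∃ b ∈ D, z = pair a (pair b ∅)) :
    (ofRel D E hD).code = relCode D E := by
  rw [code_eq]
  refine congrArg (relCode D) ?_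
  ext z
  rw [mem_relSet]
  constructor
  · rintro ⟨a, b, h, rfl⟩
    exact h
  · intro hz
    obtain ⟨a, ha, b, hb, rfl⟩ := hE z hz
    exact ⟨⟨a, ha⟩, ⟨b, hb⟩, hz, rfl⟩

/-! ### The class of structures isomorphic to a level -/

/-- The structures isomorphic to some `(V_ (o + 1), ∈)`. -/
def levelClass : Set (SetStr vocab.{u}) :=
  {A | ∃ o, A.toMSStr.Isomorphic (str o).toMSStr}

theorem isomorphic_str_iff {M : MSStr.{u + 1, u + 1} vocab.{u}.lang} {o : Ordinal.{u}} :
    M.Isomorphic (str o).toMSStr ↔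
      ∃ e : (s : vocab.{u}.sorts) → M.Dom s ≃ V_ (o + 1), IsIso M o e := by
  constructor
  · rintro ⟨e, he, -⟩
    exact ⟨e, fun r x => (he r x).trans Iff.rfl⟩
  · rintro ⟨e, he⟩
    exact ⟨e, fun r x => (he r x).trans Iff.rfl, fun f => (notMem_empty _ f.2).elim⟩

theorem _root_.MSStr.Isomorphic.symm_trans {L : MSLang.{u}} {M N K : MSStr.{u, u} L}
    (h₁ : M.Isomorphic N) (h₂ : M.Isomorphic K) : N.Isomorphic K := by
  obtain ⟨e, he, he'⟩ := h₁
  obtain ⟨f, hf, hf'⟩ := h₂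
  refine ⟨fun s => (e s).symm.trans (f s), fun r x => ?_, fun g x => ?_⟩
  · have h := he r fun i => (e _).symm (x i)
    simp only [Equiv.apply_symm_apply] at h
    rw [← h, hf]
    rfl
  · have h := he' g fun i => (e _).symm (x i)
    simp only [Equiv.apply_symm_apply] at h
    rw [← h]
    simp [hf']

/-- `p` is an isomorphism from `(D, E)` to `(m, ∈)`. -/
def IsIsoSet (D E m p : ZFSet.{u}) : Prop :=
  (∀ a ∈ D, ∃ v ∈ m, pair a v ∈ p) ∧ (∀ v ∈ m, ∃ a ∈ D, pair a v ∈ p) ∧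
    ∀ a ∈ D, ∀ b ∈ D, ∀ v ∈ m, ∀ w ∈ m, pair a v ∈ p → pair b w ∈ p →
      ((a = b ↔ v = w) ∧ (pair a (pair b ∅) ∈ E ↔ v ∈ w))

/-- The set `y` witnesses that `x` is a structure isomorphic to some `(V_ (o + 1), ∈)`. -/
def IsLevelWitness (x y : ZFSet.{u}) : Prop :=
  ∃ D ∈ y, ∃ E ∈ y, ∃ m ∈ y, ∃ h ∈ y, ∃ p ∈ y, x = relCode D E ∧
    (∀ z ∈ E, ∃ a ∈ D, ∃ b ∈ D, z = pair a (pair b ∅)) ∧ IsHistory h ∧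
    (∃ w ∈ h, m = powerset w) ∧ IsIsoSet D E m p

theorem isDelta0_isIsoSet {n : ℕ} {D E m p : (Fin n → ZFSet.{u}) → ZFSet.{u}}
    (hD : IsVar D) (hE : IsVar E) (hm : IsVar m) (hp : IsVar p) :
    IsDelta0 fun x => IsIsoSet (D x) (E x) (m x) (p x) := by
  refine .and (.ball hD (.bex hm.tail (.pair_mem (IsVar.proj 0).tail (.proj 0) hp.tail.tail)))
    (.and (.ball hm (.bex hD.tail (.pair_mem (.proj 0) (IsVar.proj 0).tail hp.tail.tail)))
    (.ball hD (.ball hD.tail (.ball hm.tail.tail (.ball hm.tail.tail.tail ?_)))))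
  have a : IsVar fun x : Fin (n + 4) → ZFSet.{u} => x 3 := .proj 3
  have b : IsVar fun x : Fin (n + 4) → ZFSet.{u} => x 2 := .proj 2
  have v : IsVar fun x : Fin (n + 4) → ZFSet.{u} => x 1 := .proj 1
  have w : IsVar fun x : Fin (n + 4) → ZFSet.{u} => x 0 := .proj 0
  exact .imp (.pair_mem a v hp.tail.tail.tail.tail) (.imp (.pair_mem b w hp.tail.tail.tail.tail)
    (.and (.iff (.eq a b) (.eq v w)) (.iff (IsDelta0Term.mem (.pair (.of_isVar a) (.pair (.of_isVar b) .empty))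
      hE.tail.tail.tail.tail) (.mem v w))))

theorem isDelta0_isLevelWitness :
    IsDelta0 fun x : Fin 2 → ZFSet.{u} => IsLevelWitness (x 0) (x 1) := by
  have y : IsVar fun x : Fin 2 → ZFSet.{u} => x 1 := .proj 1
  refine .bex y (.bex y.tail (.bex y.tail.tail (.bex y.tail.tail.tail
    (.bex y.tail.tail.tail.tail ?_))))
  have x : IsVar fun x : Fin 7 → ZFSet.{u} => x 5 := .proj 5
  have D : IsVar fun x : Fin 7 → ZFSet.{u} => x 4 := .proj 4
  have E : IsVar fun x : Fin 7 → ZFSet.{u} => x 3 := .proj 3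
  have m : IsVar fun x : Fin 7 → ZFSet.{u} => x 2 := .proj 2
  have h : IsVar fun x : Fin 7 → ZFSet.{u} => x 1 := .proj 1
  have p : IsVar fun x : Fin 7 → ZFSet.{u} => x 0 := .proj 0
  refine .and (IsDelta0Term.eq (.pair (.singleton (.pair .empty (.of_isVar D))) (.pair (.singleton (.pair .empty
    (.of_isVar E))) (.pair .empty .empty))) x) (.and (.ball E (.bex D.tail (.bex D.tail.tail ?_)))
    (.and (.isHistory h) (.and (.bex h (.eq_powerset m.tail (.proj 0)))
      (isDelta0_isIsoSet D E m p))))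
  exact IsDelta0Term.eq (.pair (.of_isVar (IsVar.proj 0).tail) (.pair (.of_isVar (.proj 0)) .empty))
    (IsVar.proj 0).tail.tail

/-- The bound holds because `V_{o+1}` is transitive and equinumerous with the domain of `A`. Thus
it, all its subsets (`levels o` among them) and all its elements have `H`-rank at most that of the
code, and the isomorphism is a set of at most that many pairs of such sets. -/
theorem exists_isLevelWitness {A : SetStr vocab.{u}} (hA : A ∈ levelClass) :
    ∃ y : ZFSet.{u}, y.hRank ≤ A.code.hRank ∧ IsLevelWitness A.code y := by
  obtain ⟨o, ho⟩ := hA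
  obtain ⟨e, he⟩ := isomorphic_str_iff.1 ho
  let g : A.dom sort ≃ V_ (o + 1) := e sort
  have hg (a b : A.dom sort) : pair (a : ZFSet.{u}) (pair b ∅) ∈ relSet A ↔
      (g a : ZFSet.{u}) ∈ (g b : ZFSet.{u}) :=
    pair_mem_relSet.trans (he _ _)
  let p : ZFSet.{u} := ZFSet.range fun a : A.dom sort => pair a (g a)
  have hp {a v : ZFSet.{u}} (ha : a ∈ A.dom sort) : pair a v ∈ p ↔ v = g ⟨a, ha⟩ := by
    rw [mem_range]
    constructor
    · rintro ⟨b, hb⟩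
      obtain ⟨rfl, rfl⟩ := pair_inj.1 hb
      rfl
    · rintro rfl
      exact ⟨⟨a, ha⟩, rfl⟩
  refine ⟨{A.dom sort, relSet A, V_ (o + 1), levels o, p}, ?_, A.dom sort, by simp, relSet A,
    by simp, V_ (o + 1), by simp, levels o, by simp, p, by simp, code_eq A, ?_,
    isHistory_levels o, ⟨V_ o, mem_levels.2 ⟨o, le_rfl, rfl⟩, vonNeumann_add_one o⟩,
    ?_, ?_, ?_⟩
  · have hc : Cardinal.aleph0 ≤ A.code.hRank := le_max_left _ _
    have hD : (A.dom sort).hRank ≤ A.code.hRank := by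
      rw [code_eq]
      exact (hRank_right_le_pair _ _).trans
        ((hRank_le_singleton _).trans (hRank_left_le_pair _ _))
    have hE : (relSet A).hRank ≤ A.code.hRank := by
      rw [code_eq]
      exact (hRank_right_le_pair _ _).trans
        ((hRank_le_singleton _).trans ((hRank_left_le_pair _ _).trans (hRank_right_le_pair _ _)))
    have hcard : (V_ (o + 1)).card ≤ A.code.hRank := by
      refine le_trans (le_of_eq ?_) ((card_le_hRank _).trans hD)
      rw [← Cardinal.lift_inj.{u, u + 1}, ← cardinalMk_coe_sort, ← cardinalMk_coe_sort]
      exact Cardinal.mk_congr g.symm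
    have hV {t : ZFSet.{u}} (ht : t ⊆ V_ (o + 1)) : t.hRank ≤ A.code.hRank :=
      hRank_le_of_subset hc (isTransitive_vonNeumann _) ht hcard
    refine hRank_insert_le hc hD (hRank_insert_le hc hE (hRank_insert_le hc (hV fun _ h => h)
      (hRank_insert_le hc (hV sep_subset) (hRank_singleton_le hc ?_))))
    refine hRank_le_of_forall hc ?_ ?_
    · refine le_trans ?_ ((card_le_hRank _).trans hD)
      rw [← Cardinal.lift_le.{u + 1}, ← cardinalMk_coe_sort (x := A.dom sort),
        ← Cardinal.lift_id'.{u, u + 1} (Cardinal.mk (A.dom sort))]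
      exact lift_card_range_le
    · intro z hz
      obtain ⟨a, rfl⟩ := mem_range.1 hz
      exact hRank_pair_le hc ((hRank_le_of_mem a.2).trans hD)
        (hV (isTransitive_vonNeumann _ _ (g a).2))
  · intro z hz
    obtain ⟨a, b, -, rfl⟩ := mem_relSet.1 hz
    exact ⟨a, a.2, b, b.2, rfl⟩
  · exact fun a ha => ⟨g ⟨a, ha⟩, (g _).2, (hp ha).2 rfl⟩
  · exact fun v hv => ⟨g.symm ⟨v, hv⟩, (g.symm _).2, (hp (g.symm _).2).2 (by simp)⟩
  · intro a ha b hb v _ w _ hv hw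
    rw [hp ha] at hv
    rw [hp hb] at hw
    subst hv hw
    refine ⟨?_, hg ⟨a, ha⟩ ⟨b, hb⟩⟩
    rw [Subtype.coe_inj, g.injective.eq_iff, Subtype.mk.injEq]

/-- The member `w` of the history is some `V_o`, so its power set is `V_{o+1}`. The equivalences in
`IsIsoSet` make `p` single-valued, injective and membership-preserving on `D`. -/
theorem IsLevelWitness.exists_code_eq {x y : ZFSet.{u}} (h : IsLevelWitness x y) :
    ∃ A ∈ levelClass.{u}, A.code = x := by
  obtain ⟨D, -, E, -, m, -, h, -, p, -, rfl, hE, hh, ⟨w, hw, rfl⟩, h₁, h₂, h₃⟩ := h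
  obtain ⟨o, ho⟩ : ∃ o, w = V_ o := ⟨_, hh.eq_vonNeumann w hw⟩
  rw [ho, ← vonNeumann_add_one] at h₁ h₂ h₃
  have hD : D.Nonempty := by
    obtain ⟨a, ha, -⟩ := h₂ (V_ o) (by simp)
    exact ⟨a, ha⟩
  refine ⟨ofRel D E hD, ⟨o, isomorphic_str_iff.2 ?_⟩, code_ofRel hD hE⟩
  choose f hf hfp using h₁
  let g : D → V_ (o + 1) := fun a => ⟨f a a.2, hf a a.2⟩
  have hg : Function.Bijective g := by
    constructor
    · intro a b hab
      exact Subtype.ext ((h₃ a a.2 b b.2 _ (g a).2 _ (g b).2 (hfp _ _) (hfp _ _)).1.2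
        (congrArg Subtype.val hab))
    · intro v
      obtain ⟨a, ha, hav⟩ := h₂ v v.2
      exact ⟨⟨a, ha⟩, Subtype.ext ((h₃ a ha a ha _ (hf a ha) v v.2 (hfp _ _) hav).1.1 rfl)⟩
  refine ⟨fun _ => Equiv.ofBijective g hg, fun r x => ?_⟩
  exact (h₃ _ (x (0 : Fin 2)).2 _ (x (1 : Fin 2)).2 _ (g (x (0 : Fin 2))).2 _
    (g (x (1 : Fin 2))).2 (hfp _ _) (hfp _ _)).2

theorem isSigma1Definable_levelClass :
    IsSigma1Definable PwSt.{u} id (SetStr.code '' levelClass.{u}) := by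
  obtain ⟨ψ, hψ⟩ := isDelta0_isLevelWitness.{u}
  refine ⟨ψ, fun x => ?_, ?_⟩
  · simp only [hψ]
    constructor
    · rintro ⟨A, hA, rfl⟩
      obtain ⟨y, -, hy⟩ := exists_isLevelWitness hA
      exact ⟨y, hy⟩
    · rintro ⟨y, hy⟩
      exact IsLevelWitness.exists_code_eq hy
  · rintro _ ⟨A, hA, rfl⟩
    obtain ⟨y, hr, hy⟩ := exists_isLevelWitness hA
    exact ⟨y, hr, (hψ _).2 hy⟩

theorem isSigma1Definable_vocab : IsSigma1Definable PwSt.{u} id {vocab.{u}.code} := by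
  have h : IsDelta0 fun x : Fin 2 → ZFSet.{u} =>
      x 0 = pair {∅} (pair {pair ∅ (pair ∅ (pair ∅ ∅))} (pair ∅ ∅)) :=
    IsDelta0Term.eq (.pair (.singleton .empty) (.pair (.singleton (.pair .empty (.pair .empty
      (.pair .empty .empty)))) (.pair .empty .empty))) (.proj 0)
  obtain ⟨ψ, hψ⟩ := h
  rw [code_vocab]
  -- The formula says nothing about the second variable, so `∅` is a dummy witness.
  refine ⟨ψ, fun x => ?_, fun x hx => ⟨∅, hRank_empty_le (le_max_left _ _), (hψ _).2 hx⟩⟩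
  simp only [hψ]
  exact ⟨fun h => ⟨∅, h⟩, fun ⟨_, h⟩ => h⟩

end LevelStr

/-! ### Embeddings preserving `Δ₀(PwSt)`-formulas -/

/-- `J` maps `V_ a` to `V_ b` and preserves all `Δ₀(PwSt)`-formulas. -/
structure IsDelta0Embedding (J : ZFSet.{u} → ZFSet.{u}) (a b : Ordinal.{u}) : Prop where
  maps : ∀ x ∈ V_ a, J x ∈ V_ b
  iff : ∀ {m : ℕ} {P : (Fin m → ZFSet.{u}) → Prop}, IsDelta0 P → ∀ x : Fin m → ZFSet.{u},
    (∀ i, x i ∈ V_ a) → (P x ↔ P fun i => J (x i))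

/-! ### The embedding of one level into a higher one obtained from reflection -/

namespace LevelStr

theorem card_eq (A : SetStr vocab.{u}) : A.card = (A.dom sort).card := by
  let f : ((s : vocab.{u}.sorts) × A.dom s) ≃ A.dom sort :=
    { toFun := fun z => (Subsingleton.elim (α := ({∅} : ZFSet.{u})) z.1 sort) ▸ z.2
      invFun := fun z => ⟨sort, z⟩
      left_inv := by
        rintro ⟨s, z⟩
        obtain rfl := Subsingleton.elim (α := ({∅} : ZFSet.{u})) sort s
        rfl
      right_inv := fun _ => rfl }
  exact Cardinal.mk_congr ((equivShrink _).symm.trans (f.trans (equivShrink _)))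

/-- The last clause transfers a property with an unbounded quantifier over the structure: the sets
in question are those of maximal rank. It is what later prevents `J` from fixing all ordinals. -/
theorem exists_embedding {κ : Cardinal.{u}} (hκ : ReflectsUpwards PwSt.{u} κ) {a : Ordinal.{u}}
    (ha : κ.ord ≤ a) :
    ∃ (b : Ordinal.{u}) (J : ZFSet.{u} → ZFSet.{u}), a < b ∧ IsDelta0Embedding J (a + 1) (b + 1) ∧
      ∀ v ∈ V_ (a + 1), (∀ z ∈ V_ (a + 1), v ∉ z) → ∀ z ∈ V_ (b + 1), J v ∉ z := by
  have hcl : ∀ A ∈ levelClass.{u}, ∀ B : SetStr vocab.{u}, A.toMSStr.Isomorphic B.toMSStr →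
      B ∈ levelClass.{u} := by
    rintro A ⟨o, ho⟩ B hB
    exact ⟨o, hB.symm_trans ho⟩
  have hA : str a ∈ levelClass.{u} :=
    ⟨a, isomorphic_str_iff.2 ⟨fun _ => Equiv.refl _, fun _ _ => Iff.rfl⟩⟩
  have hc : κ ≤ (str a).card := by
    rw [card_eq]
    calc κ = κ.ord.card := (Cardinal.card_ord κ).symm
      _ ≤ (V_ κ.ord).card := Ordinal.card_le_card_vonNeumann _
      _ ≤ (V_ (a + 1)).card := card_mono (vonNeumann_subset_of_le (ha.trans le_self_add))
  -- Requiring more elements than `V_{a+1}` has forces `b > a`.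
  obtain ⟨B, ⟨b, hB⟩, hBc, f, hf⟩ := hκ id isDefinablyBounding_id vocab isSigma1Definable_vocab
    levelClass hcl isSigma1Definable_levelClass (str a) hA hc (Order.succ (str a).card)
    (Order.lt_succ_of_le hc)
  obtain ⟨e, he⟩ := isomorphic_str_iff.1 hB
  have hab : a < b := by
    by_contra! hba
    refine (Order.succ_le_iff.1 hBc).not_ge ?_
    rw [card_eq, card_eq]
    refine le_trans (le_of_eq ?_) (card_mono (vonNeumann_subset_of_le (add_le_add_left hba 1)))
    exact Cardinal.mk_congr ((equivShrink _).symm.trans ((e sort).trans (equivShrink _)))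
  classical
  -- The elementary map into `B` followed by the isomorphism onto `V_{b+1}`; the value `∅` outside
  -- the domain is never used.
  let J : ZFSet.{u} → ZFSet.{u} := fun x =>
    if h : x ∈ V_ (a + 1) then (e sort (f sort ⟨x, h⟩) : ZFSet.{u}) else ∅
  have hJ (s : vocab.{u}.sorts) (z : V_ (a + 1)) : (e s (f s z) : ZFSet.{u}) = J z := by
    obtain rfl := Subsingleton.elim (α := ({∅} : ZFSet.{u})) sort s
    simp only [J]
    rw [dif_pos z.2]
    rfl
  have transfer {Γ : List vocab.{u}.sorts}
      {P : Ordinal.{u} → (Fin Γ.length → ZFSet.{u}) → Prop} (hP : IsFO Γ P)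
      (x : Fin Γ.length → ZFSet.{u}) (hx : ∀ i, x i ∈ V_ (a + 1)) :
      P a x ↔ P b fun i => J (x i) := by
    obtain ⟨ψ, hψ⟩ := hP
    have h₁ := hψ (str a).toMSStr a (fun _ => Equiv.refl _) (fun _ _ => Iff.rfl)
      fun i => ⟨x i, hx i⟩
    have h₂ := hψ B.toMSStr b e he fun i => f _ ⟨x i, hx i⟩
    refine h₁.symm.trans ((hf Γ ψ _).trans (h₂.trans (iff_of_eq (congrArg (P b) ?_))))
    exact funext fun i => hJ _ _
  refine ⟨b, J, hab, ⟨fun x hx => ?_, ?_⟩, ?_⟩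
  · rw [← hJ sort ⟨x, hx⟩]
    exact (e sort _).2
  · rintro m P ⟨φ, hφ⟩ x hx
    have hl : (List.replicate m (sort : vocab.{u}.sorts)).length = m := List.length_replicate
    have := transfer (isFO_holds φ (List.replicate m sort) (Fin.cast hl.symm))
      (fun i => x (Fin.cast hl i)) (fun i => hx _)
    rw [← hφ, ← hφ]
    exact this
  · intro v hv h
    exact (transfer (Γ := [sort]) (P := fun o x => ∀ z ∈ V_ (o + 1), x (0 : Fin 1) ∉ z)
      (.all (Γ := [sort]) (P := fun _ x z => x (0 : Fin 1) ∉ z)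
        (IsFO.mem (Γ := [sort, sort]) (1 : Fin 2) (0 : Fin 2)).not) (fun _ => v) (fun _ => hv)).1 h

end LevelStr

namespace IsDelta0Embedding

variable {J : ZFSet.{u} → ZFSet.{u}} {a b : Ordinal.{u}} (hJ : IsDelta0Embedding J a b)

include hJ

theorem iff_one {P : ZFSet.{u} → Prop} (hP : IsDelta0 fun x : Fin 1 → ZFSet.{u} => P (x 0))
    {x : ZFSet.{u}} (hx : x ∈ V_ a) : P x ↔ P (J x) :=
  hJ.iff hP ![x] (by simpa using hx)

theorem iff_two {P : ZFSet.{u} → ZFSet.{u} → Prop}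
    (hP : IsDelta0 fun x : Fin 2 → ZFSet.{u} => P (x 0) (x 1))
    {x y : ZFSet.{u}} (hx : x ∈ V_ a) (hy : y ∈ V_ a) : P x y ↔ P (J x) (J y) :=
  hJ.iff hP ![x, y] (by simp [Fin.forall_fin_two, hx, hy])

theorem iff_three {P : ZFSet.{u} → ZFSet.{u} → ZFSet.{u} → Prop}
    (hP : IsDelta0 fun x : Fin 3 → ZFSet.{u} => P (x 0) (x 1) (x 2))
    {x y z : ZFSet.{u}} (hx : x ∈ V_ a) (hy : y ∈ V_ a) (hz : z ∈ V_ a) :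
    P x y z ↔ P (J x) (J y) (J z) :=
  hJ.iff hP ![x, y, z] (by simp [Fin.forall_fin_succ, hx, hy, hz])

theorem mem_iff {x y : ZFSet.{u}} (hx : x ∈ V_ a) (hy : y ∈ V_ a) : x ∈ y ↔ J x ∈ J y :=
  hJ.iff_two (P := fun x y => x ∈ y) (.mem (.proj 0) (.proj 1)) hx hy

/-- The restriction to a set is an elementary embedding. -/
theorem exists_restriction {w : ZFSet.{u}} (hw : w ∈ V_ a) :
    ∃ j : FirstOrder.Language.ElementaryEmbedding setLang w (J w),
      ∀ x : w, (j x : ZFSet.{u}) = J x := by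
  have hV {x : ZFSet.{u}} (hx : x ∈ w) : x ∈ V_ a := isTransitive_vonNeumann a w hw hx
  refine ⟨⟨fun x => ⟨J x, (hJ.mem_iff (hV x.2) hw).1 x.2⟩, fun m φ x => ?_⟩, fun _ => rfl⟩
  obtain ⟨ψ, hψ⟩ := exists_relativization φ (0 : Fin (m + 1)) Fin.succ finZeroElim
  have h₁ := hψ (Fin.cons w fun i => (x i : ZFSet.{u})) (fun i => (x i).2) (fun i => i.elim0)
  have h₂ := hψ (Fin.cons (J w) fun i => J (x i)) (fun i => (hJ.mem_iff (hV (x i).2) hw).1 (x i).2)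
    (fun i => i.elim0)
  have h₃ := hJ.iff ⟨ψ, fun _ => Iff.rfl⟩ (Fin.cons w fun i => (x i : ZFSet.{u})) (fun i => by
    cases i using Fin.cases with
    | zero => exact hw
    | succ i => exact hV (x i).2)
  have h₄ : (fun i => J ((Fin.cons w fun i => (x i : ZFSet.{u}) : Fin (m + 1) → ZFSet.{u}) i)) =
      Fin.cons (J w) fun i => J (x i) := by
    funext i
    cases i using Fin.cases <;> rfl
  rw [h₄] at h₃
  refine Iff.trans (iff_of_eq ?_) (h₂.symm.trans (h₃.symm.trans (h₁.trans (iff_of_eq ?_))))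
  · exact congrArg (FirstOrder.Language.BoundedFormula.Realize φ _) (Subsingleton.elim _ _)
  · exact congrArg (FirstOrder.Language.BoundedFormula.Realize φ _) (Subsingleton.elim _ _)

/-- The image of a level is a level. -/
theorem exists_map_vonNeumann {o : Ordinal.{u}} (ho : o + 2 < a) : ∃ ζ, J (V_ o) = V_ ζ := by
  have h₁ : V_ o ∈ V_ a := vonNeumann_mem_of_lt (le_self_add.trans_lt ho)
  have h₂ : levels o ∈ V_ a := by
    refine mem_vonNeumann.2 (lt_of_le_of_lt ?_ ho)
    exact (subset_vonNeumann.1 sep_subset).trans (add_le_add_right one_le_two o)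
  -- Being a member of a given history is preserved by `J`, and members of histories are levels.
  have h := (hJ.iff_two (P := fun h v => IsHistory h ∧ v ∈ h)
    (.and (.isHistory (.proj 0)) (.mem (.proj 1) (.proj 0))) h₂ h₁).1
    ⟨isHistory_levels o, mem_levels.2 ⟨o, le_rfl, rfl⟩⟩
  exact ⟨_, h.1.eq_vonNeumann _ h.2⟩

/-- Being an ordinal is `Δ₀`, so `J μ` is an ordinal; it includes `μ` because everything below `μ`
is fixed, and it differs from `μ`. -/
theorem toZFSet_mem_of_ne {μ : Ordinal.{u}} (hμ : μ < a)
    (hfix : ∀ o < μ, J o.toZFSet = o.toZFSet) (hne : J μ.toZFSet ≠ μ.toZFSet) :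
    μ.toZFSet ∈ J μ.toZFSet := by
  have hV {o : Ordinal.{u}} (ho : o < a) : o.toZFSet ∈ V_ a := by simpa [mem_vonNeumann] using ho
  have hord : (J μ.toZFSet).IsOrdinal :=
    (hJ.iff_one (P := ZFSet.IsOrdinal) (.isOrdinal (.proj 0)) (hV hμ)).1 (isOrdinal_toZFSet μ)
  have hsub : μ.toZFSet ⊆ J μ.toZFSet := by
    intro x hx
    obtain ⟨o, ho, rfl⟩ := Ordinal.mem_toZFSet_iff.1 hx
    rw [← hfix o ho]
    exact (hJ.mem_iff (hV (ho.trans hμ)) (hV hμ)).1 hx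
  exact (((isOrdinal_toZFSet μ).subset_iff_eq_or_mem hord).1 hsub).resolve_left hne.symm

/-- The least ordinal that is moved is zero or a limit. -/
theorem isSuccPrelimit_of_ne {μ : Ordinal.{u}} (hμ : μ < a)
    (hfix : ∀ o < μ, J o.toZFSet = o.toZFSet) (hne : J μ.toZFSet ≠ μ.toZFSet) :
    Order.IsSuccPrelimit μ := by
  have hV {o : Ordinal.{u}} (ho : o < a) : o.toZFSet ∈ V_ a := by simpa [mem_vonNeumann] using ho
  by_contra h
  obtain ⟨ν, rfl⟩ := Order.not_isSuccPrelimit_iff_mem_range_succ.1 h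
  have hν : ν < Order.succ ν := Order.lt_succ ν
  refine hne ?_
  have := (hJ.iff_two (P := fun x y => x = insert y y)
    (.eq_insert (.proj 0) (.proj 1) (.proj 1)) (hV hμ) (hV (hν.trans hμ))).1
    (Ordinal.toZFSet_add_one ν)
  rw [this, hfix ν hν]
  exact (Ordinal.toZFSet_add_one ν).symm

theorem ne_zero_of_ne {μ : Ordinal.{u}} (hμ : μ < a) (hne : J μ.toZFSet ≠ μ.toZFSet) : μ ≠ 0 := by
  rintro rfl
  rw [Ordinal.toZFSet_zero] at hne
  exact hne ((hJ.iff_one (P := fun x => x = ∅) (.eq_empty (.proj 0))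
    (by simpa [mem_vonNeumann] using hμ)).1 rfl)

/-- The least ordinal that is moved is a cardinal. -/
theorem ord_card_of_ne {μ : Ordinal.{u}} (hμ : μ + 2 < a)
    (hfix : ∀ o < μ, J o.toZFSet = o.toZFSet) (hne : J μ.toZFSet ≠ μ.toZFSet) :
    μ.card.ord = μ := by
  have hμa : μ < a := le_self_add.trans_lt hμ
  have hV {o : Ordinal.{u}} (ho : o < a) : o.toZFSet ∈ V_ a := by simpa [mem_vonNeumann] using ho
  have hlim := hJ.isSuccPrelimit_of_ne hμa hfix hne
  refine (Cardinal.ord_card_le μ).antisymm ?_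
  by_contra! hγ
  set γ := μ.card.ord with hγ_def
  have hcard : γ.toZFSet.card = μ.toZFSet.card := by simp [hγ_def]
  obtain ⟨g⟩ := Cardinal.eq.1 hcard
  let f : γ.toZFSet ≃ μ.toZFSet := (equivShrink _).trans (g.trans (equivShrink _).symm)
  -- The graph of a bijection from `γ < μ` onto `μ`. Its image is a function from the fixed `γ` onto
  -- `J μ`, so it takes the value `μ` at some `x ∈ γ`. But `x` and `F(x) ∈ μ` are fixed, so the
  -- value at `x` is still `F(x)`, giving `μ ∈ μ`.
  let F : ZFSet.{u} := ZFSet.range fun z : γ.toZFSet => pair z (f z)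
  have hpair {x y : ZFSet.{u}} : pair x y ∈ F ↔ ∃ h : x ∈ γ.toZFSet, (f ⟨x, h⟩ : ZFSet.{u}) = y := by
    rw [mem_range]
    constructor
    · rintro ⟨z, hz⟩
      obtain ⟨rfl, rfl⟩ := pair_inj.1 hz
      exact ⟨z.2, rfl⟩
    · rintro ⟨h, rfl⟩
      exact ⟨⟨x, h⟩, rfl⟩
  -- Since `μ` is closed under successors, pairs of sets of rank below `μ` have rank below `μ`;
  -- hence `F` has rank at most `μ` and lies in the domain of `J`.
  have hrank {x y : ZFSet.{u}} (hx : x.rank < μ) (hy : y.rank < μ) : (pair x y).rank < μ := by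
    rw [pair, rank_pair, rank_singleton, rank_pair]
    have h₁ := hlim.succ_lt hx
    have h₂ := hlim.succ_lt hy
    exact max_lt (hlim.succ_lt h₁) (hlim.succ_lt (max_lt h₁ h₂))
  have hrank' {x : ZFSet.{u}} (hx : x ∈ μ.toZFSet) : x.rank < μ := by
    simpa using rank_lt_of_mem hx
  have hFV : F ∈ V_ a := by
    refine mem_vonNeumann.2 (lt_of_le_of_lt (rank_le_iff.2 fun z hz => ?_) hμa)
    obtain ⟨z, rfl⟩ := mem_range.1 hz
    exact hrank (hrank' (Ordinal.toZFSet_monotone hγ.le z.2)) (hrank' (f z).2)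
  have hmem := hJ.toZFSet_mem_of_ne hμa hfix hne
  have key := (hJ.iff_three (P := fun F γ μ => (∀ y ∈ μ, ∃ x ∈ γ, pair x y ∈ F) ∧
      ∀ x ∈ γ, ∀ y ∈ μ, ∀ z ∈ μ, pair x y ∈ F → pair x z ∈ F → y = z)
    (.and (.ball (.proj 2) (.bex (IsVar.proj 1).tail (.pair_mem (.proj 0) (IsVar.proj 0).tail
      (IsVar.proj 0).tail.tail))) (.ball (.proj 1) (.ball (IsVar.proj 2).tail
      (.ball (IsVar.proj 2).tail.tail (.imp (.pair_mem (IsVar.proj 0).tail.tail (IsVar.proj 0).tail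
        (IsVar.proj 0).tail.tail.tail) (.imp (.pair_mem (IsVar.proj 0).tail.tail (.proj 0)
          (IsVar.proj 0).tail.tail.tail) (.eq (IsVar.proj 0).tail (.proj 0))))))))
    hFV (hV (hγ.trans hμa)) (hV hμa)).1 ⟨fun y hy => ⟨f.symm ⟨y, hy⟩, (f.symm _).2,
      hpair.2 ⟨(f.symm _).2, by simp⟩⟩, fun x hx y _ z _ h₁ h₂ => by
        obtain ⟨_, rfl⟩ := hpair.1 h₁
        obtain ⟨_, rfl⟩ := hpair.1 h₂
        rfl⟩
  rw [hfix γ hγ] at key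
  obtain ⟨x, hx, hxF⟩ := key.1 _ hmem
  have fixed {z : ZFSet.{u}} (hz : z ∈ μ.toZFSet) : J z = z := by
    obtain ⟨o, ho, rfl⟩ := Ordinal.mem_toZFSet_iff.1 hz
    exact hfix o ho
  have hxμ : x ∈ μ.toZFSet := Ordinal.toZFSet_monotone hγ.le hx
  set y := f ⟨x, hx⟩ with hy
  have hxV : x ∈ V_ a := mem_vonNeumann.2 ((hrank' hxμ).trans hμa)
  have hyV : (y : ZFSet.{u}) ∈ V_ a := mem_vonNeumann.2 ((hrank' y.2).trans hμa)
  have hxyF := (hJ.iff_three (P := fun x y F => pair x y ∈ F)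
    (.pair_mem (.proj 0) (.proj 1) (.proj 2)) hxV hyV hFV).1 (hpair.2 ⟨hx, rfl⟩)
  rw [fixed hxμ, fixed y.2] at hxyF
  have hyJ : (y : ZFSet.{u}) ∈ J μ.toZFSet := by
    rw [← fixed y.2]
    exact (hJ.mem_iff hyV (hV hμa)).1 y.2
  have hyμ := key.2 x hx y hyJ _ hmem hxyF hxF
  exact mem_irrefl _ (hyμ ▸ y.2)

/-- The least ordinal that is moved is `n`-extendible. -/
theorem isExtendible_of_ne {μ : Ordinal.{u}} {n : ℕ} (hn : 0 < n) (hμ : μ + (n + 2 : ℕ) < a)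
    (hfix : ∀ o < μ, J o.toZFSet = o.toZFSet) (hne : J μ.toZFSet ≠ μ.toZFSet) :
    IsExtendible (n : Ordinal.{u}) μ.card := by
  have h2 : μ + 2 < a := by
    refine lt_of_le_of_lt (add_le_add_right ?_ μ) hμ
    exact_mod_cast Nat.le_add_left 2 n
  have hμa : μ < a := le_self_add.trans_lt hμ
  have hn2 : μ + n + 2 < a := by
    rw [add_assoc]
    exact_mod_cast hμ
  have hV {o : Ordinal.{u}} (ho : o < a) : o.toZFSet ∈ V_ a := by simpa [mem_vonNeumann] using ho
  have hw : V_ (μ + n) ∈ V_ a := vonNeumann_mem_of_lt (le_self_add.trans_lt hn2)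
  obtain ⟨ζ, hζ⟩ := hJ.exists_map_vonNeumann hn2
  obtain ⟨j, hj⟩ : ∃ j : FirstOrder.Language.ElementaryEmbedding setLang (V_ (μ + n)) (V_ ζ),
      ∀ x : V_ (μ + n), (j x : ZFSet.{u}) = J x := by
    rw [← hζ]
    exact hJ.exists_restriction hw
  have hmem := hJ.toZFSet_mem_of_ne hμa hfix hne
  have hlim : Order.IsSuccLimit μ :=
    Ordinal.isSuccLimit_iff.2 ⟨hJ.ne_zero_of_ne hμa hne, hJ.isSuccPrelimit_of_ne hμa hfix hne⟩
  rw [IsExtendible, hJ.ord_card_of_ne h2 hfix hne]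
  refine ⟨ζ, j, ⟨μ.toZFSet, ?_⟩, rfl, fun x hx => ?_, ?_, ?_⟩
  -- Here `n > 0` is needed: `μ` itself is not an element of `V_μ`.
  · rw [mem_vonNeumann, Ordinal.rank_toZFSet]
    exact lt_add_of_pos_right μ (by exact_mod_cast hn)
  · obtain ⟨o, ho, hxo⟩ := Ordinal.mem_toZFSet_iff.1 hx
    rw [hj, ← hxo, hfix o ho]
  · rw [hj]
    exact hne
  · rw [hj]
    have hord : (J μ.toZFSet).IsOrdinal :=
      (hJ.iff_one (P := ZFSet.IsOrdinal) (.isOrdinal (.proj 0)) (hV hμa)).1 (isOrdinal_toZFSet μ)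
    -- `n < ω ≤ μ < J μ`, as `μ` is a nonzero limit.
    refine hord.mem_trans (Ordinal.toZFSet_mem_toZFSet_iff.2 ?_) hmem
    exact (Ordinal.natCast_lt_omega0 n).trans_le (Ordinal.omega0_le_of_isSuccLimit hlim)

end IsDelta0Embedding

/-! ### The extendible cardinal at or below the reflection number -/

theorem theorem7p5 (h : ∃ κ : Cardinal.{u}, IsUSR PwSt.{u} κ) (n : ℕ) (hn : 0 < n) :
    ∃ κ : Cardinal.{u}, IsExtendible (n : Ordinal.{u}) κ := by
  obtain ⟨κ, hκ, -⟩ := h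
  -- The height `κ + n + 2` leaves room for `V_{μ+n}` and its set of levels once `μ ≤ κ`, while
  -- adding only successors above `κ`.
  obtain ⟨b, J, hab, hJ, htop⟩ := LevelStr.exists_embedding hκ
    (a := κ.ord + (n + 2 : ℕ)) le_self_add
  set a := κ.ord + (n + 2 : ℕ) with ha
  have hex : ∃ o, J o.toZFSet ≠ o.toZFSet ∧ o ≤ a := by
    by_contra! hfix
    have hfix : J a.toZFSet = a.toZFSet := by
      by_contra hne
      exact (hfix a hne).false
    -- If `a` were fixed, it would belong to no element of `V_{b+1}`, being of top rank in
    -- `V_{a+1}`; but `{a} ∈ V_{b+1}` because `a < b`.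
    refine htop a.toZFSet (mem_vonNeumann.2 (by simp)) (fun z hz hza => ?_) {a.toZFSet} ?_
      (by simp [hfix])
    · have h₁ := rank_lt_of_mem hza
      rw [Ordinal.rank_toZFSet] at h₁
      exact (Order.lt_add_one_iff.1 (mem_vonNeumann.1 hz)).not_gt h₁
    · rw [mem_vonNeumann, rank_singleton, Ordinal.rank_toZFSet, Order.lt_add_one_iff]
      exact Order.succ_le_of_lt hab
  obtain ⟨μ, ⟨hne, hμa⟩, hmin⟩ := WellFounded.has_min (wellFounded_lt (α := Ordinal.{u}))
    {o | J o.toZFSet ≠ o.toZFSet ∧ o ≤ a} hex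
  have hfix (o : Ordinal.{u}) (ho : o < μ) : J o.toZFSet = o.toZFSet := by
    by_contra hne'
    exact hmin o ⟨hne', ho.le.trans hμa⟩ ho
  have hlim := hJ.isSuccPrelimit_of_ne (Order.lt_add_one_iff.2 hμa) hfix hne
  -- Otherwise `μ = κ + k` with `k` a positive natural number, a successor.
  have hμ : μ ≤ κ.ord := by
    by_contra! hlt
    obtain ⟨c, rfl⟩ := exists_add_of_le hlt.le
    have hc : c ≤ (n + 2 : ℕ) := by simpa [ha] using hμa
    obtain ⟨k, rfl⟩ := Ordinal.lt_omega0.1 (hc.trans_lt (Ordinal.natCast_lt_omega0 _))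
    cases k with
    | zero => simp at hlt
    | succ k =>
      push_cast at hlim
      rw [← add_assoc] at hlim
      exact hlim.succ_lt (Order.lt_add_one_iff.2 le_rfl) |>.false
  exact ⟨μ.card, hJ.isExtendible_of_ne hn
    (Order.lt_add_one_iff.2 (add_le_add_left hμ _)) hfix hne⟩
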